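/- Let $k$ be a field, $d\ge 1$ an integer, and let $\mathcal C$ be a $k$-linear additive category that is Hom-finite (all $\operatorname{Hom}_{\mathcal C}(X,Y)$ are finite-dimensional over $k$) and Krull–Schmidt (every object is a finite direct sum of objects with local endomorphism rings). Let $\Sigma^d:\mathcal C\to\mathcal C$ be an automorphism (an autoequivalence suffices), and let $\Theta$ be a class of sequences $$A_0\xrightarrow{\alpha_0}A_1\xrightarrow{\alpha_1}\cdots\xrightarrow{\alpha_{d}}A_{d+1}\xrightarrow{\alpha_{d+1}}\Sigma^dA_0$$ such that $(\mathcal C,\Sigma^d,\Theta)$ is a $(d+2)$-angulated category in the sense of Geiss–Keller–Oppermann; that is: * (N1) $\Theta$ is closed under isomorphisms, direct sums and direct summands; it contains $A\xrightarrow{1}A\to0\to\cdots\to0\to\Sigma^dA$ for every object $A$; and every morphism $\alpha_0:A_0\to A_1$ is the first morphism of a sequence in $\Theta$. * (N2) A sequence as above belongs to $\Theta$ if and only if its left rotation $A_1\xrightarrow{\alpha_1}\cdots\xrightarrow{\alpha_d}A_{d+1}\xrightarrow{\alpha_{d+1}}\Sigma^dA_0\xrightarrow{(-1)^d\Sigma^d\alpha_0}\Sigma^dA_1$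 does. * (N3) If $(A_\bullet,\alpha)$, $(B_\bullet,\beta)$ belong to $\Theta$ and $\varphi_0:A_0\to B_0$, $\varphi_1:A_1\to B_1$ satisfy $\varphi_1\alpha_0=\beta_0\varphi_0$, then there are $\varphi_2,\dots,\varphi_{d+1}$ such that $(\varphi_0,\dots,\varphi_{d+1})$ is a morphism of sequences, i.e. $\varphi_{i+1}\alpha_i=\beta_i\varphi_i$ for $0\le i\le d$ and $\Sigma^d\varphi_0\,\alpha_{d+1}=\beta_{d+1}\varphi_{d+1}$. * (N4) In (N3), $\varphi_2,\dots,\varphi_{d+1}$ can be chosen such that moreover the mapping cone $$A_1\oplus B_0\to A_2\oplus B_1\to\cdots\to A_{d+1}\oplus B_d\to\Sigma^dA_0\oplus B_{d+1}\to\Sigma^dA_1\oplus\Sigma^dB_0$$ belongs to $\Theta$, whose morphisms are $\begin{pmatrix}-\alpha_{i+1}&0\\ \varphi_{i+1}&\beta_i\end{pmatrix}$ for $0\le i\le d$, followed by $\begin{pmatrix}-\Sigma^d\alpha_0&0\\ \Sigma^d\varphi_0&\beta_{d+1}\end{pmatrix}$. The elements of $\Theta$ are called $(d+2)$-angles. A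 morphism $f:X\to Y$ is *left almost split* if it is not a section and every morphism $X\to M$ that is not a section factors through $f$; it is *right almost split* if it is not a retraction and every morphism $M\to Y$ that is not a retraction factors through $f$. The radical $\operatorname{rad}_{\mathcal C}(X,Y)$ consists of those $f:X\to Y$ such that $1_X-gf$ is invertible for all $g:Y\to X$. A $(d+2)$-angle as above is an *Auslander–Reiten $(d+2)$-angle* if $\alpha_0$ is left almost split, $\alpha_d$ is right almost split and, when $d\ge2$, $\alpha_1,\dots,\alpha_{d-1}$ lie in $\operatorname{rad}_{\mathcal C}$; it *starts* at $A_0$ and *ends* at $A_{d+1}$ (indecomposable objects being considered up to isomorphism). Suppose that $\mathcal C$ is locally finite: for every indecomposable object $X$ there are, up to isomorphism, only finitely many indecomposable objects $Y$ with $\operatorname{Hom}_{\mathcal C}(X,Y)\ne0$, and only finitely many with $\operatorname{Hom}_{\mathcal C}(Y,X)\neq0$. Then for every indecomposable object $X$ of $\mathcal C$ there exists an Auslander–Reiten $(d+2)$-angle ending at $X$, and for every indecomposable object $X$ of $\mathcal C$ there exists an Auslander–Reiten $(d+2)$-angle starting at $X$. Thus $\mathcal C$ has Auslander–Reiten $(d+2)$-angles.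 -/

import Mathlib

open CategoryTheory CategoryTheory.Limits

universe w v u

noncomputable section

namespace HigherAngulated

variable {C : Type u} [Category.{v} C] [Preadditive C] [HasZeroObject C]
  [HasBinaryBiproducts C]

/-- A `(d+2)`-`S`-sequence
`A_0 ⟶ A_1 ⟶ ⋯ ⟶ A_{d+1} ⟶ S A_0`; here `map i : A_i ⟶ A_{i+1}` for `0 ≤ i ≤ d`
and `conn` is the last morphism `A_{d+1} ⟶ S A_0`. -/
structure SigmaSeq (S : C ⥤ C) (d : ℕ) where
  obj : Fin (d + 2) → C
  map : ∀ i : Fin (d + 1), obj i.castSucc ⟶ obj i.succ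
  conn : obj (Fin.last (d + 1)) ⟶ S.obj (obj 0)

namespace SigmaSeq

variable {S : C ⥤ C} {d : ℕ}

/-- The first morphism `A_0 ⟶ A_1`. -/
def first (A : SigmaSeq S d) : A.obj 0 ⟶ A.obj 1 := A.map 0

/-- Morphisms of `(d+2)`-`S`-sequences. -/
@[ext]
structure Hom (A B : SigmaSeq S d) where
  hom : ∀ i : Fin (d + 2), A.obj i ⟶ B.obj i
  comm : ∀ i : Fin (d + 1), A.map i ≫ hom i.succ = hom i.castSucc ≫ B.map i
  comm_conn : A.conn ≫ S.map (hom 0) = hom (Fin.last (d + 1)) ≫ B.conn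

/-- A morphism of sequences is an isomorphism if all its components are. -/
def Hom.IsIsomorphism {A B : SigmaSeq S d} (φ : Hom A B) : Prop :=
  ∀ i, IsIso (φ.hom i)

/-- The direct sum of two sequences. -/
def sum (A B : SigmaSeq S d) : SigmaSeq S d where
  obj i := A.obj i ⊞ B.obj i
  map i := biprod.map (A.map i) (B.map i)
  conn := biprod.desc (A.conn ≫ S.map biprod.inl) (B.conn ≫ S.map biprod.inr)

open scoped ZeroObject in
/-- The trivial sequence `X ⟶ X ⟶ 0 ⟶ ⋯ ⟶ 0 ⟶ S X`, whose first morphism is the identity. -/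
def trivial (S : C ⥤ C) (d : ℕ) (X : C) : SigmaSeq S d where
  obj := Fin.cases (motive := fun _ => C) X (Fin.cases (motive := fun _ => C) X (fun _ => 0))
  map := Fin.cases
    (motive := fun i : Fin (d + 1) =>
      (Fin.cases (motive := fun _ => C) X (Fin.cases (motive := fun _ => C) X (fun _ => 0))
          i.castSucc : C) ⟶
        Fin.cases (motive := fun _ => C) X (Fin.cases (motive := fun _ => C) X (fun _ => 0))
          i.succ)
    (𝟙 X) (fun _ => 0)
  conn := 0

/-- The objects `A_1, …, A_{d+1}, S A_0` of the left rotation. -/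
def rotObj (A : SigmaSeq S d) : Fin (d + 2) → C :=
  Fin.snoc (α := fun _ => C) (fun i : Fin (d + 1) => A.obj i.succ) (S.obj (A.obj 0))

/-- The identity of `A_{i+1}`, which is the object number `i` of the left rotation. -/
def rotIso (A : SigmaSeq S d) (i : Fin (d + 1)) : A.rotObj i.castSucc ≅ A.obj i.succ :=
  eqToIso (Fin.snoc_castSucc (α := fun _ => C) _ _ i)

/-- The identity of `A_1`, which is the first object of the left rotation. -/
def rotIsoFirst (A : SigmaSeq S d) : A.rotObj 0 ≅ A.obj 1 := A.rotIso 0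

/-- The identity of `S A_0`, which is the last object of the left rotation. -/
def rotIsoLast (A : SigmaSeq S d) : A.rotObj (Fin.last (d + 1)) ≅ S.obj (A.obj 0) :=
  eqToIso (Fin.snoc_last (α := fun _ => C) _ _)

/-- The first `d+1` morphisms `A_1 ⟶ A_2 ⟶ ⋯ ⟶ A_{d+1} ⟶ S A_0` of the left rotation. -/
def rotMap (A : SigmaSeq S d) (i : Fin (d + 1)) : A.rotObj i.castSucc ⟶ A.rotObj i.succ :=
  (A.rotIso i).hom ≫
    Fin.lastCases (motive := fun i : Fin (d + 1) => A.obj i.succ ⟶ A.rotObj i.succ)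
      (A.conn ≫ A.rotIsoLast.inv)
      (fun j : Fin d => A.map j.succ ≫ (A.rotIso j.succ).inv) i

/-- The left rotation
`A_1 ⟶ A_2 ⟶ ⋯ ⟶ A_{d+1} ⟶ S A_0 ⟶ S A_1`, with last morphism `(-1)^d S(first)`. -/
def rotate (A : SigmaSeq S d) : SigmaSeq S d where
  obj := A.rotObj
  map := A.rotMap
  conn := A.rotIsoLast.hom ≫ ((-1 : ℤ) ^ d • S.map A.first) ≫ S.map A.rotIsoFirst.inv

/-- The mapping cone of `φ : A ⟶ B`:
`A_1 ⊞ B_0 ⟶ A_2 ⊞ B_1 ⟶ ⋯ ⟶ S A_0 ⊞ B_{d+1} ⟶ S (A_1 ⊞ B_0)`.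
Writing `a` for the morphisms of `A` and `b` for those of `B`, the matrices are
`(-a_{i+1}, 0; φ_{i+1}, b_i)` and, at the end, `(-S a_0, 0; S φ_0, b_{d+1})`. -/
def cone {A B : SigmaSeq S d} (φ : Hom A B) : SigmaSeq S d where
  obj i := A.rotObj i ⊞ B.obj i
  map i := Biprod.ofComponents (-A.rotMap i) ((A.rotIso i).hom ≫ φ.hom i.succ) 0 (B.map i)
  conn := biprod.desc
    (A.rotIsoLast.hom ≫
      (-S.map (A.first ≫ A.rotIsoFirst.inv ≫ biprod.inl) + S.map (φ.hom 0 ≫ biprod.inr)))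
    (B.conn ≫ S.map biprod.inr)

end SigmaSeq

open SigmaSeq

/-- `(C, S, Θ)` is a `(d+2)`-angulated category: the axioms (N1)–(N4) of Geiss, Keller and
Oppermann for the class `Θ` of `(d+2)`-angles. -/
structure IsAngulated (S : C ⥤ C) (d : ℕ) (Θ : Set (SigmaSeq S d)) : Prop where
  /-- (N1)(a) `Θ` is closed under isomorphisms. -/
  of_iso : ∀ (A B : SigmaSeq S d) (φ : Hom A B), φ.IsIsomorphism → A ∈ Θ → B ∈ Θ
  /-- (N1)(a) `Θ` is closed under direct sums. -/
  sum_mem : ∀ A B : SigmaSeq S d, A ∈ Θ → B ∈ Θ → A.sum B ∈ Θ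
  /-- (N1)(a) `Θ` is closed under direct summands. -/
  summand_mem : ∀ A B : SigmaSeq S d, A.sum B ∈ Θ → A ∈ Θ
  /-- (N1)(b) Trivial sequences are `(d+2)`-angles. -/
  trivial_mem : ∀ X : C, SigmaSeq.trivial S d X ∈ Θ
  /-- (N1)(c) Every morphism is, up to isomorphism, the first morphism of a `(d+2)`-angle. -/
  exists_extension : ∀ {X Y : C} (f : X ⟶ Y), ∃ A ∈ Θ,
    ∃ (e₀ : A.obj 0 ≅ X) (e₁ : A.obj 1 ≅ Y), A.first ≫ e₁.hom = e₀.hom ≫ f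
  /-- (N2) -/
  rotate_mem_iff : ∀ A : SigmaSeq S d, A.rotate ∈ Θ ↔ A ∈ Θ
  /-- (N3) -/
  exists_hom : ∀ A ∈ Θ, ∀ B ∈ Θ, ∀ (φ₀ : A.obj 0 ⟶ B.obj 0) (φ₁ : A.obj 1 ⟶ B.obj 1),
    A.first ≫ φ₁ = φ₀ ≫ B.first →
      ∃ φ : Hom A B, φ.hom 0 = φ₀ ∧ φ.hom 1 = φ₁
  /-- (N4) -/
  exists_hom_cone : ∀ A ∈ Θ, ∀ B ∈ Θ,
    ∀ (φ₀ : A.obj 0 ⟶ B.obj 0) (φ₁ : A.obj 1 ⟶ B.obj 1), A.first ≫ φ₁ = φ₀ ≫ B.first →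
      ∃ φ : Hom A B, φ.hom 0 = φ₀ ∧ φ.hom 1 = φ₁ ∧ cone φ ∈ Θ

/-- `f` lies in the Jacobson radical `rad(X, Y)` of the category: for every `g : Y ⟶ X`, the
endomorphism `1 - g ∘ f` of `X` is invertible. -/
def IsRadical {X Y : C} (f : X ⟶ Y) : Prop :=
  ∀ g : Y ⟶ X, IsIso (𝟙 X - f ≫ g)

/-- `f` is left almost split: it is not a section, and every morphism out of its source that is
not a section factors through it. -/
def IsLeftAlmostSplit {X Y : C} (f : X ⟶ Y) : Prop :=
  ¬ IsSplitMono f ∧ ∀ ⦃M : C⦄ (g : X ⟶ M), ¬ IsSplitMono g → ∃ t : Y ⟶ M, f ≫ t = g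

/-- `f` is right almost split: it is not a retraction, and every morphism into its target that
is not a retraction factors through it. -/
def IsRightAlmostSplit {X Y : C} (f : X ⟶ Y) : Prop :=
  ¬ IsSplitEpi f ∧ ∀ ⦃M : C⦄ (g : M ⟶ Y), ¬ IsSplitEpi g → ∃ t : M ⟶ X, t ≫ f = g

/-- `A` is an Auslander–Reiten `(d+2)`-angle. -/
structure IsAuslanderReiten {S : C ⥤ C} {d : ℕ} (Θ : Set (SigmaSeq S d))
    (A : SigmaSeq S d) : Prop where
  mem : A ∈ Θ
  left : IsLeftAlmostSplit A.first
  right : IsRightAlmostSplit (A.map (Fin.last d))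
  radical : ∀ i : Fin (d + 1), i ≠ 0 → i ≠ Fin.last d → IsRadical (A.map i)

/-- `C` has Auslander–Reiten `(d+2)`-angles: every indecomposable object is, up to isomorphism,
the end term of one of them and the first term of one of them. -/
def HasAuslanderReitenAngles {S : C ⥤ C} {d : ℕ} (Θ : Set (SigmaSeq S d)) : Prop :=
  ∀ X : C, Indecomposable X →
    (∃ A, IsAuslanderReiten Θ A ∧ Nonempty (A.obj (Fin.last (d + 1)) ≅ X)) ∧
    (∃ A, IsAuslanderReiten Θ A ∧ Nonempty (A.obj 0 ≅ X))

variable (C) in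
/-- `C` is Krull–Schmidt: every object is a finite direct sum of objects whose endomorphism
rings are local. -/
def IsKrullSchmidt : Prop :=
  ∀ X : C, ∃ (n : ℕ) (Y : Fin n → C) (b : Bicone Y),
    (∀ i, IsLocalRing (End (Y i))) ∧ Nonempty b.IsBilimit ∧ Nonempty (b.pt ≅ X)

variable (C) in
/-- `C` is locally finite: for every indecomposable `X` there are, up to isomorphism, only
finitely many indecomposables `Y` with `Hom(X, Y) ≠ 0`, and only finitely many with
`Hom(Y, X) ≠ 0`. -/
def IsLocallyFinite : Prop :=
  ∀ X : C, Indecomposable X →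
    {c : Quotient (isIsomorphicSetoid C) |
      ∃ Y : C, ⟦Y⟧ = c ∧ Indecomposable Y ∧ ∃ f : X ⟶ Y, f ≠ 0}.Finite ∧
    {c : Quotient (isIsomorphicSetoid C) |
      ∃ Y : C, ⟦Y⟧ = c ∧ Indecomposable Y ∧ ∃ f : Y ⟶ X, f ≠ 0}.Finite

end HigherAngulated

end

/-! Everything reduces to one nonzero morphism `γ : X ⟶ S Z` that is annihilated by all
nonretractions into `X` and, after applying `S`, by all nonsections out of `Z`. Consecutive
morphisms of an angle are weak kernels and weak cokernels of each other
(`IsAngulated.weakExact_map`, `IsAngulated.weakExact_last_conn`,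
`IsAngulated.weakExact_conn_first`). So in any angle with connecting morphism `γ`, the vanishing
conditions say exactly that nonsections factor through the first morphism and nonretractions through
the one before `γ`, while `γ ≠ 0` keeps these two from splitting. The middle morphisms are made
radical by splitting off contractible summands `Z' ⟶ Z'`, which leaves `γ` untouched and lowers the
total dimension of the endomorphism algebras (`IsAngulated.exists_smaller`).

To find `γ` ending at `X`, local finiteness and Hom-finiteness give a right almost split `f : Y ⟶
X`, assembled from bases of the finitely many relevant spaces of nonretractions. In an angle
starting with `f`, the next morphism is nonzero, because `f` is not a retraction, and is annihilated
by all nonretractions. One of its components into a summand with local endomorphism ring is nonzero,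
and this is `γ`. Its second vanishing property comes for free from locality
(`IsAngulated.comp_eq_zero_of_nonsection`). Starting at `X`, the argument is dual and uses the
connecting morphism of an angle on a left almost split morphism. -/

namespace HigherAngulated

/-! ### Local endomorphism rings and the radical -/

section LocalEnd

variable {C : Type u} [Category.{v} C] [Preadditive C]

theorem hasFiniteBiproducts_of_binary (C : Type u) [Category.{v} C] [Preadditive C]
    [HasZeroObject C] [HasBinaryBiproducts C] : HasFiniteBiproducts C :=
  have : HasFiniteProducts C := hasFiniteProducts_of_has_binary_and_terminal
  HasFiniteBiproducts.of_hasFiniteProducts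

theorem isIso_or_isIso_of_add {X Y : C} (hX : IsLocalRing (End X)) {f g : X ⟶ Y}
    (h : IsIso (f + g)) : IsIso f ∨ IsIso g := by
  let a : End X := f ≫ inv (f + g)
  let b : End X := g ≫ inv (f + g)
  have h1 : a + b = 1 :=
    (Preadditive.add_comp _ _ _ f g (inv (f + g))).symm.trans (IsIso.hom_inv_id (f + g))
  rcases IsLocalRing.isUnit_or_isUnit_of_add_one h1 with h2 | h2
  · left
    have : IsIso (f ≫ inv (f + g)) := (isUnit_iff_isIso a).1 h2
    exact IsIso.of_isIso_comp_right f (inv (f + g))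
  · right
    have : IsIso (g ≫ inv (f + g)) := (isUnit_iff_isIso b).1 h2
    exact IsIso.of_isIso_comp_right g (inv (f + g))

theorem isIso_or_isIso_one_sub {X : C} (hX : IsLocalRing (End X)) (f : X ⟶ X) :
    IsIso f ∨ IsIso (𝟙 X - f) :=
  isIso_or_isIso_of_add hX (by rw [add_sub_cancel]; infer_instance)

theorem id_ne_zero_of_local {X : C} (hX : IsLocalRing (End X)) : 𝟙 X ≠ 0 :=
  fun h => one_ne_zero (α := End X) h

theorem exists_isIso_of_sum {ι : Type*} {X Y : C} (hX : IsLocalRing (End X)) (s : Finset ι)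
    (f : ι → (X ⟶ Y)) (h : IsIso (∑ i ∈ s, f i)) : ∃ i ∈ s, IsIso (f i) := by
  classical
  induction s using Finset.induction_on with
  | empty =>
    exfalso
    rw [Finset.sum_empty] at h
    apply id_ne_zero_of_local hX
    rw [← IsIso.hom_inv_id (0 : X ⟶ Y), zero_comp]
  | insert a s ha ih =>
    rw [Finset.sum_insert ha] at h
    rcases isIso_or_isIso_of_add hX h with h | h
    · exact ⟨a, Finset.mem_insert_self _ _, h⟩
    · obtain ⟨i, hi, h⟩ := ih h
      exact ⟨i, Finset.mem_insert_of_mem hi, h⟩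

/-- A split monomorphism between objects with local endomorphism rings is invertible. -/
theorem comp_eq_id_of_local {X Y : C} (hX : IsLocalRing (End X)) (hY : IsLocalRing (End Y))
    {f : X ⟶ Y} {g : Y ⟶ X} (h : f ≫ g = 𝟙 X) : g ≫ f = 𝟙 Y := by
  rcases isIso_or_isIso_one_sub hY (g ≫ f) with h1 | h1
  · rw [← cancel_epi (g ≫ f)]
    simp [reassoc_of% h]
  · exfalso
    have h2 : g ≫ f = 0 := by
      rw [← cancel_epi (𝟙 Y - g ≫ f)]
      simp [reassoc_of% h]
    apply id_ne_zero_of_local hX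
    calc 𝟙 X = f ≫ (g ≫ f) ≫ g := by simp [h]
      _ = 0 := by simp [h2]

theorem isLocalRing_end_of_iso {X Y : C} (e : X ≅ Y) (hX : IsLocalRing (End X)) :
    IsLocalRing (End Y) := by
  have : Nontrivial (End Y) := by
    refine ⟨1, 0, fun h => id_ne_zero_of_local hX ?_⟩
    have h' : 𝟙 Y = 0 := h
    calc 𝟙 X = e.hom ≫ 𝟙 Y ≫ e.inv := by simp
      _ = 0 := by simp [h']
  refine IsLocalRing.of_is_unit_or_is_unit_of_add_one fun {a b} hab => ?_
  have hab' : (a : Y ⟶ Y) + b = 𝟙 Y := hab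
  have : IsIso ((e.hom ≫ (a : Y ⟶ Y)) + e.hom ≫ (b : Y ⟶ Y)) := by
    rw [← Preadditive.comp_add, hab']; infer_instance
  rcases isIso_or_isIso_of_add hX this with h | h
  · exact Or.inl ((isUnit_iff_isIso _).2 (IsIso.of_isIso_comp_left e.hom (a : Y ⟶ Y)))
  · exact Or.inr ((isUnit_iff_isIso _).2 (IsIso.of_isIso_comp_left e.hom (b : Y ⟶ Y)))

theorem isSplitEpi_or_isSplitEpi_of_add {X Y : C} (hY : IsLocalRing (End Y)) {f g : X ⟶ Y}
    (h : IsSplitEpi (f + g)) : IsSplitEpi f ∨ IsSplitEpi g := by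
  obtain ⟨⟨s, hs⟩⟩ := h
  rw [Preadditive.comp_add] at hs
  rcases isIso_or_isIso_of_add hY (f := s ≫ f) (g := s ≫ g) (hs ▸ inferInstance) with h | h
  · exact Or.inl ⟨⟨inv (s ≫ f) ≫ s, by simp⟩⟩
  · exact Or.inr ⟨⟨inv (s ≫ g) ≫ s, by simp⟩⟩

theorem isSplitMono_or_isSplitMono_of_add {X Y : C} (hX : IsLocalRing (End X)) {f g : X ⟶ Y}
    (h : IsSplitMono (f + g)) : IsSplitMono f ∨ IsSplitMono g := by
  obtain ⟨⟨s, hs⟩⟩ := h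
  rw [Preadditive.add_comp] at hs
  rcases isIso_or_isIso_of_add hX (f := f ≫ s) (g := g ≫ s) (hs ▸ inferInstance) with h | h
  · exact Or.inl ⟨⟨s ≫ inv (f ≫ s), by rw [← Category.assoc, IsIso.hom_inv_id]⟩⟩
  · exact Or.inr ⟨⟨s ≫ inv (g ≫ s), by rw [← Category.assoc, IsIso.hom_inv_id]⟩⟩

/-- The Jacobson identity: if `1 - ab` has inverse `c`, then `1 - ba` has inverse `1 + bca`. This
avoids assuming that the radical is a two-sided ideal. -/
theorem IsRadical.comp_left {X Y Z : C} {f : Y ⟶ Z} (hf : IsRadical f) (h : X ⟶ Y) :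
    IsRadical (h ≫ f) := by
  intro g
  have h1 := hf (g ≫ h)
  refine ⟨𝟙 X + h ≫ inv (𝟙 Y - f ≫ g ≫ h) ≫ f ≫ g, ?_, ?_⟩
  · have h3 : h ≫ f ≫ g ≫ h ≫ inv (𝟙 Y - f ≫ g ≫ h) ≫ f ≫ g
        = h ≫ inv (𝟙 Y - f ≫ g ≫ h) ≫ f ≫ g - h ≫ f ≫ g := by
      have : (f ≫ g ≫ h) ≫ inv (𝟙 Y - f ≫ g ≫ h) = inv (𝟙 Y - f ≫ g ≫ h) - 𝟙 Y := by
        rw [eq_sub_iff_add_eq, add_comm, ← eq_sub_iff_add_eq]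
        have := IsIso.hom_inv_id (𝟙 Y - f ≫ g ≫ h)
        rw [Preadditive.sub_comp, Category.id_comp, sub_eq_iff_eq_add] at this
        exact eq_sub_iff_add_eq.2 this.symm
      have := congrArg (fun x => h ≫ x ≫ f ≫ g) this
      simpa using this
    simp only [Preadditive.sub_comp, Preadditive.comp_add, Category.id_comp, Category.comp_id,
      Category.assoc, h3]
    abel
  · have h3 : h ≫ inv (𝟙 Y - f ≫ g ≫ h) ≫ f ≫ g ≫ h ≫ f ≫ g
        = h ≫ inv (𝟙 Y - f ≫ g ≫ h) ≫ f ≫ g - h ≫ f ≫ g := by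
      have : inv (𝟙 Y - f ≫ g ≫ h) ≫ (f ≫ g ≫ h) = inv (𝟙 Y - f ≫ g ≫ h) - 𝟙 Y := by
        rw [eq_sub_iff_add_eq, add_comm, ← eq_sub_iff_add_eq]
        have := IsIso.inv_hom_id (𝟙 Y - f ≫ g ≫ h)
        rw [Preadditive.comp_sub, Category.comp_id, sub_eq_iff_eq_add] at this
        exact eq_sub_iff_add_eq.2 this.symm
      have := congrArg (fun x => h ≫ x ≫ f ≫ g) this
      simpa using this
    simp only [Preadditive.comp_sub, Preadditive.add_comp, Category.id_comp, Category.comp_id,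
      Category.assoc, h3]
    abel

theorem IsRadical.add {X Y : C} {f f' : X ⟶ Y} (hf : IsRadical f) (hf' : IsRadical f') :
    IsRadical (f + f') := by
  intro g
  have h1 := hf g
  have h2 := hf'.comp_left (inv (𝟙 X - f ≫ g)) g
  have h3 : 𝟙 X - (f + f') ≫ g
      = (𝟙 X - f ≫ g) ≫ (𝟙 X - (inv (𝟙 X - f ≫ g) ≫ f') ≫ g) := by
    rw [Preadditive.comp_sub, Category.comp_id, Category.assoc, IsIso.hom_inv_id_assoc,
      Preadditive.add_comp]
    abel
  rw [h3]
  infer_instance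

theorem IsRadical.sum {ι : Type*} {X Y : C} (s : Finset ι) {f : ι → (X ⟶ Y)}
    (hf : ∀ i ∈ s, IsRadical (f i)) : IsRadical (∑ i ∈ s, f i) := by
  classical
  induction s using Finset.induction_on with
  | empty =>
    intro g
    rw [Finset.sum_empty, zero_comp, sub_zero]
    infer_instance
  | insert a s ha ih =>
    rw [Finset.sum_insert ha]
    exact (hf a (Finset.mem_insert_self _ _)).add
      (ih fun i hi => hf i (Finset.mem_insert_of_mem hi))

end LocalEnd

/-! ### Krull–Schmidt decompositions and complements -/

section KrullSchmidt

variable {C : Type u} [Category.{v} C] [Preadditive C]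

theorem IsKrullSchmidt.exists_decomposition (hKS : IsKrullSchmidt C) (X : C) :
    ∃ (n : ℕ) (Y : Fin n → C) (ι : ∀ i, Y i ⟶ X) (π : ∀ i, X ⟶ Y i),
      (∀ i, IsLocalRing (End (Y i))) ∧ (∀ i, ι i ≫ π i = 𝟙 (Y i)) ∧
      (∀ i j, i ≠ j → ι i ≫ π j = 0) ∧ ∑ i, π i ≫ ι i = 𝟙 X := by
  obtain ⟨n, Y, b, hY, ⟨hb⟩, ⟨e⟩⟩ := hKS X
  refine ⟨n, Y, fun i => b.ι i ≫ e.hom, fun i => e.inv ≫ b.π i, hY, fun i => ?_,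
    fun i j hij => ?_, ?_⟩
  · simp
  · simp [bicone_ι_π_ne b hij]
  · have := congrArg (fun x => e.inv ≫ x ≫ e.hom) (IsBilimit.total hb)
    simpa [Preadditive.comp_sum, Preadditive.sum_comp] using this

/-- A non-radical morphism restricts to an isomorphism on some summand with local endomorphism
ring. -/
theorem IsKrullSchmidt.exists_of_not_isRadical (hKS : IsKrullSchmidt C) {X Y : C} {f : X ⟶ Y}
    (hf : ¬ IsRadical f) : ∃ (Z : C) (s : Z ⟶ X) (t : Y ⟶ Z), IsLocalRing (End Z) ∧
      s ≫ f ≫ t = 𝟙 Z := by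
  by_contra! hc
  apply hf
  obtain ⟨n, Y, ι, π, hY, h1, h2, h3⟩ := hKS.exists_decomposition X
  have : f = ∑ i, π i ≫ ι i ≫ f := by
    have := congrArg (fun x => x ≫ f) h3
    simpa [Preadditive.sum_comp] using this.symm
  rw [this]
  refine IsRadical.sum _ fun i _ => IsRadical.comp_left ?_ _
  intro g
  -- If this endomorphism of the local summand were invertible, `ι i` and `g` followed by its
  -- inverse would be the excluded pair `s`, `t`.
  rcases isIso_or_isIso_one_sub (hY i) ((ι i ≫ f) ≫ g) with h | h
  · exact absurd (by simpa only [Category.assoc] using IsIso.hom_inv_id ((ι i ≫ f) ≫ g))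
      (hc _ (ι i) (g ≫ inv ((ι i ≫ f) ≫ g)) (hY i))
  · exact h

variable [HasBinaryBiproducts C]

theorem indecomposable_of_local {X : C} (hX : IsLocalRing (End X)) : Indecomposable X := by
  refine ⟨fun h => id_ne_zero_of_local hX (h.eq_of_src _ _), fun Y Z a => ?_⟩
  have : IsIso (a.hom ≫ biprod.fst ≫ biprod.inl ≫ a.inv +
      a.hom ≫ biprod.snd ≫ biprod.inr ≫ a.inv) := by
    have : a.hom ≫ biprod.fst ≫ biprod.inl ≫ a.inv +
      a.hom ≫ biprod.snd ≫ biprod.inr ≫ a.inv = 𝟙 X := by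
      have := a.hom ≫= biprod.total (X := Y) (Y := Z) =≫ a.inv
      simpa only [Preadditive.add_comp, Preadditive.comp_add, Category.assoc, Category.id_comp,
        Iso.hom_inv_id] using this
    rw [this]; infer_instance
  rcases isIso_or_isIso_of_add hX this with h | h
  · right
    rw [IsZero.iff_id_eq_zero]
    have : biprod.inr ≫ a.inv = (0 : Z ⟶ X) := by
      rw [← cancel_mono (a.hom ≫ biprod.fst ≫ biprod.inl ≫ a.inv)]; simp
    calc 𝟙 Z = (biprod.inr ≫ a.inv) ≫ a.hom ≫ biprod.snd := by simp
      _ = 0 := by rw [this, zero_comp]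
  · left
    rw [IsZero.iff_id_eq_zero]
    have : biprod.inl ≫ a.inv = (0 : Y ⟶ X) := by
      rw [← cancel_mono (a.hom ≫ biprod.snd ≫ biprod.inr ≫ a.inv)]; simp
    calc 𝟙 Y = (biprod.inl ≫ a.inv) ≫ a.hom ≫ biprod.fst := by simp
      _ = 0 := by rw [this, zero_comp]

variable [HasZeroObject C]

/-- The complement of one summand of a finite direct sum decomposition. -/
theorem exists_complement {n : ℕ} {X : C} {Y : Fin n → C} {ι : ∀ i, Y i ⟶ X} {π : ∀ i, X ⟶ Y i}
    (h1 : ∀ i, ι i ≫ π i = 𝟙 (Y i)) (h2 : ∀ i j, i ≠ j → ι i ≫ π j = 0)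
    (h3 : ∑ i, π i ≫ ι i = 𝟙 X) (l : Fin n) :
    ∃ (W : C) (j : W ⟶ X) (p : X ⟶ W), j ≫ p = 𝟙 W ∧ p ≫ j = 𝟙 X - π l ≫ ι l ∧
      j ≫ π l = 0 ∧ ι l ≫ p = 0 := by
  classical
  have := hasFiniteBiproducts_of_binary C
  refine ⟨⨁ (fun i : {i : Fin n // i ≠ l} => Y i), biproduct.desc fun i => ι i,
    biproduct.lift fun i => π i, ?_, ?_, ?_, ?_⟩
  · ext i j
    by_cases hij : i = j
    · subst hij
      simp [h1]
    · rw [Category.id_comp, biproduct.ι_π_ne _ (Ne.symm hij)]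
      simp [h2 j i (fun h => hij (Subtype.ext h.symm))]
  · rw [biproduct.lift_desc, ← h3, eq_sub_iff_add_eq,
      ← Finset.sum_erase_add _ _ (Finset.mem_univ l)]
    congr 1
    exact (Finset.sum_subtype (Finset.univ.erase l) (by simp) fun i => π i ≫ ι i).symm
  · ext i
    simp [h2 i l i.2]
  · ext i
    simp [h2 l i i.2.symm]

/-- In a Krull–Schmidt category, an idempotent whose image has a local endomorphism ring has a
kernel complement. -/
theorem IsKrullSchmidt.exists_complement (hKS : IsKrullSchmidt C) {X Z : C}
    (hZ : IsLocalRing (End Z)) {s : Z ⟶ X} {r : X ⟶ Z} (h : s ≫ r = 𝟙 Z) :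
    ∃ (W : C) (j : W ⟶ X) (p : X ⟶ W), j ≫ p = 𝟙 W ∧ p ≫ j = 𝟙 X - r ≫ s := by
  obtain ⟨n, Y, ι, π, hY, h1, h2, h3⟩ := hKS.exists_decomposition X
  have h4 : IsIso (∑ i, s ≫ π i ≫ ι i ≫ r) := by
    have : ∑ i, s ≫ π i ≫ ι i ≫ r = 𝟙 Z := by
      have := congrArg (fun x => s ≫ x ≫ r) h3
      simpa [Preadditive.comp_sum, Preadditive.sum_comp, h] using this
    rw [this]; infer_instance
  -- Exchange argument: the identity of `Z` is a sum over the summands of `X`, so by locality one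
  -- term is invertible and `Z` can replace that `Y l`.
  obtain ⟨l, -, h5⟩ := exists_isIso_of_sum hZ _ _ h4
  have h6 : (inv (s ≫ π l ≫ ι l ≫ r) ≫ s ≫ π l) ≫ (ι l ≫ r) = 𝟙 Z := by simp
  have h7 := comp_eq_id_of_local hZ (hY l) h6
  have : IsIso (ι l ≫ r) := ⟨_, h7, h6⟩
  obtain ⟨W, j, p, h8, h9, h10, h11⟩ := HigherAngulated.exists_complement h1 h2 h3 l
  -- The complement `W` of `Y l` also complements `Z`, once its inclusion is corrected along `Y l`
  -- so that `r` annihilates it, and its projection so that it annihilates `s`.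
  refine ⟨W, j ≫ (𝟙 X - r ≫ inv (ι l ≫ r) ≫ ι l), (𝟙 X - r ≫ s) ≫ p, ?_, ?_⟩
  · have : (𝟙 X - r ≫ inv (ι l ≫ r) ≫ ι l) ≫ r = 0 := by simp
    have : (𝟙 X - r ≫ inv (ι l ≫ r) ≫ ι l) ≫ (𝟙 X - r ≫ s)
        = 𝟙 X - r ≫ inv (ι l ≫ r) ≫ ι l := by
      rw [Preadditive.comp_sub, reassoc_of% this]; simp
    rw [Category.assoc, reassoc_of% this]
    simp [h8, h11]
  · have h12 : (𝟙 X - r ≫ s) ≫ r = 0 := by simp [h]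
    rw [Category.assoc, reassoc_of% h9]
    have h13 : (𝟙 X - π l ≫ ι l) ≫ (𝟙 X - r ≫ inv (ι l ≫ r) ≫ ι l)
        = 𝟙 X - r ≫ inv (ι l ≫ r) ≫ ι l := by
      have : ι l ≫ r ≫ inv (ι l ≫ r) ≫ ι l = ι l := by
        rw [← Category.assoc (ι l), IsIso.hom_inv_id_assoc]
      simp [this]
    rw [h13, Preadditive.comp_sub, Category.comp_id, reassoc_of% h12]
    simp

/-- A summand with local endomorphism ring is nonzero, so indecomposability forces its complement to
vanish. -/
theorem IsKrullSchmidt.isLocalRing_end (hKS : IsKrullSchmidt C) {X : C} (hX : Indecomposable X) :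
    IsLocalRing (End X) := by
  obtain ⟨n, Y, ι, π, hY, h1, h2, h3⟩ := hKS.exists_decomposition X
  have hn : 0 < n := by
    rcases Nat.eq_zero_or_pos n with rfl | h
    · exfalso
      apply hX.1
      rw [IsZero.iff_id_eq_zero, ← h3]
      simp
    · exact h
  let l : Fin n := ⟨0, hn⟩
  obtain ⟨W, j, p, h8, h9, h10, h11⟩ := HigherAngulated.exists_complement h1 h2 h3 l
  have e : X ≅ Y l ⊞ W :=
    { hom := biprod.lift (π l) p
      inv := biprod.desc (ι l) j
      hom_inv_id := by rw [biprod.lift_desc, h9]; abel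
      inv_hom_id := by
        ext <;> simp [h1, h8, h10, h11] }
  rcases hX.2 _ _ e with h | h
  · exact absurd (h.eq_of_src _ _) (id_ne_zero_of_local (hY l))
  · have hj : j = 0 := h.eq_of_src _ _
    refine isLocalRing_end_of_iso (X := Y l) ⟨ι l, π l, h1 l, ?_⟩ (hY l)
    rw [hj, comp_zero] at h9
    exact (sub_eq_zero.1 h9.symm).symm

end KrullSchmidt

end HigherAngulated

namespace HigherAngulated

/-! ### Almost split morphisms from local finiteness -/

section AlmostSplit

variable {k : Type w} [Field k] {C : Type u} [Category.{v} C] [Preadditive C] [Linear k C]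

variable (k) in
/-- The morphisms `Y ⟶ X` that are not retractions, for `X` with local endomorphism ring. -/
def nonretractions (Y : C) {X : C} (hX : IsLocalRing (End X)) : Submodule k (Y ⟶ X) where
  carrier := {f | ¬ IsSplitEpi f}
  add_mem' := fun ha hb h => (isSplitEpi_or_isSplitEpi_of_add hX h).elim ha hb
  zero_mem' := by
    rintro ⟨⟨s, hs⟩⟩
    exact id_ne_zero_of_local hX (by simpa using hs.symm)
  smul_mem' := by
    rintro c f hf ⟨⟨s, hs⟩⟩
    exact hf ⟨⟨c • s, by simpa using hs⟩⟩

variable (k) in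
/-- The morphisms `X ⟶ Y` that are not sections, for `X` with local endomorphism ring. -/
def nonsections {X : C} (Y : C) (hX : IsLocalRing (End X)) : Submodule k (X ⟶ Y) where
  carrier := {f | ¬ IsSplitMono f}
  add_mem' := fun ha hb h => (isSplitMono_or_isSplitMono_of_add hX h).elim ha hb
  zero_mem' := by
    rintro ⟨⟨s, hs⟩⟩
    exact id_ne_zero_of_local hX (by simpa using hs.symm)
  smul_mem' := by
    rintro c f hf ⟨⟨s, hs⟩⟩
    exact hf ⟨⟨c • s, by simpa using hs⟩⟩

variable [HasZeroObject C] [HasBinaryBiproducts C]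

/-- In a locally finite Hom-finite Krull–Schmidt category, every indecomposable object is the
target of a right almost split morphism. -/
theorem exists_isRightAlmostSplit (hfin : ∀ X Y : C, FiniteDimensional k (X ⟶ Y))
    (hKS : IsKrullSchmidt C) (hlf : IsLocallyFinite C) {X : C} (hX : Indecomposable X) :
    ∃ (Y : C) (f : Y ⟶ X), IsRightAlmostSplit f := by
  classical
  have := hasFiniteBiproducts_of_binary C
  have hL := hKS.isLocalRing_end hX
  obtain ⟨-, hF⟩ := hlf X hX
  set s := {c : Quotient (isIsomorphicSetoid C) |
      ∃ Y : C, ⟦Y⟧ = c ∧ Indecomposable Y ∧ ∃ f : Y ⟶ X, f ≠ 0}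
  have := hF.fintype
  let B (c : s) := Module.finBasis k (nonretractions k c.1.out hL)
  -- One summand for each basis vector of each space of nonretractions; `J` is finite by local
  -- finiteness and Hom-finiteness.
  let J := Σ c : s, Fin (Module.finrank k (nonretractions k c.1.out hL))
  let φ : ∀ j : J, (j.1.1.out ⟶ X) := fun j => (B j.1 j.2).1
  refine ⟨⨁ fun j : J => j.1.1.out, biproduct.desc φ, ?_, fun M g hg => ?_⟩
  · rintro ⟨⟨t, ht⟩⟩
    -- A section would write the identity of `X` as a sum over `J`; by locality some basis vector `φ
    -- j` would be a retraction.
    have h1 : IsIso (∑ j : J, t ≫ biproduct.π (fun j : J => j.1.1.out) j ≫ φ j) := by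
      have : ∑ j : J, t ≫ biproduct.π (fun j : J => j.1.1.out) j ≫ φ j = 𝟙 X := by
        have := t ≫= IsBilimit.total (biproduct.isBilimit fun j : J => j.1.1.out) =≫
          biproduct.desc φ
        rw [Category.id_comp, ht] at this
        simpa [Preadditive.comp_sum, Preadditive.sum_comp] using this
      rw [this]; infer_instance
    obtain ⟨j, -, hj⟩ := exists_isIso_of_sum hL _ _ h1
    exact (B j.1 j.2).2 ⟨⟨inv (t ≫ biproduct.π (fun j : J => j.1.1.out) j ≫ φ j) ≫ t ≫
      biproduct.π (fun j : J => j.1.1.out) j, by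
      simp only [Category.assoc]
      exact IsIso.inv_hom_id (t ≫ biproduct.π (fun j : J => j.1.1.out) j ≫ φ j)⟩⟩
  · have key : ∀ (c : s) (g : c.1.out ⟶ X), ¬ IsSplitEpi g →
        ∃ u : c.1.out ⟶ ⨁ fun j : J => j.1.1.out, u ≫ biproduct.desc φ = g := by
      intro c g hg
      let g' : nonretractions k c.1.out hL := ⟨g, hg⟩
      refine ⟨∑ i, (B c).repr g' i • biproduct.ι (fun j : J => j.1.1.out) ⟨c, i⟩, ?_⟩
      have h1 := congrArg Subtype.val ((B c).sum_repr g')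
      rw [Preadditive.sum_comp]
      simp only [Linear.smul_comp, biproduct.ι_desc]
      rw [AddSubmonoidClass.coe_finsetSum] at h1
      exact h1
    obtain ⟨n, Y, ι, π, hY, h1, h2, h3⟩ := hKS.exists_decomposition M
    have h4 : ∀ i, ∃ u : Y i ⟶ ⨁ fun j : J => j.1.1.out, u ≫ biproduct.desc φ = ι i ≫ g := by
      intro i
      -- Only classes admitting a nonzero morphism to `X` belong to `s`, so vanishing components are
      -- treated apart.
      by_cases h0 : ι i ≫ g = 0
      · exact ⟨0, by rw [h0, zero_comp]⟩
      · have hc : (⟦Y i⟧ : Quotient (isIsomorphicSetoid C)) ∈ s :=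
          ⟨Y i, rfl, indecomposable_of_local (hY i), _, h0⟩
        obtain ⟨e⟩ : IsIsomorphic (Quotient.out ⟦Y i⟧) (Y i) :=
          @Quotient.mk_out C (isIsomorphicSetoid C) (Y i)
        obtain ⟨u, hu⟩ := key ⟨_, hc⟩ (e.hom ≫ ι i ≫ g) (by
          rintro ⟨⟨t, ht⟩⟩
          exact hg ⟨⟨t ≫ e.hom ≫ ι i, by simpa using ht⟩⟩)
        exact ⟨e.inv ≫ u, by rw [Category.assoc, hu, Iso.inv_hom_id_assoc]⟩
    choose u hu using h4
    refine ⟨∑ i, π i ≫ u i, ?_⟩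
    rw [Preadditive.sum_comp]
    simp only [Category.assoc, hu]
    simpa [Preadditive.sum_comp] using h3 =≫ g

/-- In a locally finite Hom-finite Krull–Schmidt category, every indecomposable object is the
source of a left almost split morphism. -/
theorem exists_isLeftAlmostSplit (hfin : ∀ X Y : C, FiniteDimensional k (X ⟶ Y))
    (hKS : IsKrullSchmidt C) (hlf : IsLocallyFinite C) {X : C} (hX : Indecomposable X) :
    ∃ (Y : C) (f : X ⟶ Y), IsLeftAlmostSplit f := by
  classical
  have := hasFiniteBiproducts_of_binary C
  have hL := hKS.isLocalRing_end hX
  obtain ⟨hF, -⟩ := hlf X hX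
  set s := {c : Quotient (isIsomorphicSetoid C) |
      ∃ Y : C, ⟦Y⟧ = c ∧ Indecomposable Y ∧ ∃ f : X ⟶ Y, f ≠ 0}
  have := hF.fintype
  let B (c : s) := Module.finBasis k (nonsections k c.1.out hL)
  let J := Σ c : s, Fin (Module.finrank k (nonsections k c.1.out hL))
  let φ : ∀ j : J, (X ⟶ j.1.1.out) := fun j => (B j.1 j.2).1
  refine ⟨⨁ fun j : J => j.1.1.out, biproduct.lift φ, ?_, fun M g hg => ?_⟩
  · rintro ⟨⟨t, ht⟩⟩
    have h1 : IsIso (∑ j : J, φ j ≫ biproduct.ι (fun j : J => j.1.1.out) j ≫ t) := by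
      have : ∑ j : J, φ j ≫ biproduct.ι (fun j : J => j.1.1.out) j ≫ t = 𝟙 X := by
        have := biproduct.lift φ ≫= IsBilimit.total (biproduct.isBilimit fun j : J => j.1.1.out)
          =≫ t
        erw [Category.id_comp, ht] at this
        simpa [Preadditive.comp_sum, Preadditive.sum_comp] using this
      rw [this]; infer_instance
    obtain ⟨j, -, hj⟩ := exists_isIso_of_sum hL _ _ h1
    exact (B j.1 j.2).2 ⟨⟨(biproduct.ι (fun j : J => j.1.1.out) j ≫ t) ≫
      inv (φ j ≫ biproduct.ι (fun j : J => j.1.1.out) j ≫ t), by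
      simpa only [Category.assoc] using
        IsIso.hom_inv_id (φ j ≫ biproduct.ι (fun j : J => j.1.1.out) j ≫ t)⟩⟩
  · have key : ∀ (c : s) (g : X ⟶ c.1.out), ¬ IsSplitMono g →
        ∃ u : (⨁ fun j : J => j.1.1.out) ⟶ c.1.out, biproduct.lift φ ≫ u = g := by
      intro c g hg
      let g' : nonsections k c.1.out hL := ⟨g, hg⟩
      refine ⟨∑ i, (B c).repr g' i • biproduct.π (fun j : J => j.1.1.out) ⟨c, i⟩, ?_⟩
      have h1 := congrArg Subtype.val ((B c).sum_repr g')
      rw [Preadditive.comp_sum]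
      simp only [Linear.comp_smul, biproduct.lift_π]
      rw [AddSubmonoidClass.coe_finsetSum] at h1
      exact h1
    obtain ⟨n, Y, ι, π, hY, h1, h2, h3⟩ := hKS.exists_decomposition M
    have h4 : ∀ i, ∃ u : (⨁ fun j : J => j.1.1.out) ⟶ Y i, biproduct.lift φ ≫ u = g ≫ π i := by
      intro i
      by_cases h0 : g ≫ π i = 0
      · exact ⟨0, by rw [h0, comp_zero]⟩
      · have hc : (⟦Y i⟧ : Quotient (isIsomorphicSetoid C)) ∈ s :=
          ⟨Y i, rfl, indecomposable_of_local (hY i), _, h0⟩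
        obtain ⟨e⟩ : IsIsomorphic (Quotient.out ⟦Y i⟧) (Y i) :=
          @Quotient.mk_out C (isIsomorphicSetoid C) (Y i)
        obtain ⟨u, hu⟩ := key ⟨_, hc⟩ (g ≫ π i ≫ e.inv) (by
          rintro ⟨⟨t, ht⟩⟩
          exact hg ⟨⟨π i ≫ e.inv ≫ t, by simpa using ht⟩⟩)
        exact ⟨u ≫ e.hom, by rw [← Category.assoc, hu]; simp⟩
    choose u hu using h4
    refine ⟨∑ i, u i ≫ ι i, ?_⟩
    rw [Preadditive.comp_sum]
    simp only [← Category.assoc, hu]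
    simpa [Preadditive.comp_sum] using g ≫= h3

end AlmostSplit

end HigherAngulated

namespace HigherAngulated

/-! ### Weak kernels and cokernels -/

section WeakExact

variable {C : Type u} [Category.{v} C] [Preadditive C]

/-- `f` is a weak kernel of `g` and `g` is a weak cokernel of `f`. -/
structure WeakExact {X Y Z : C} (f : X ⟶ Y) (g : Y ⟶ Z) : Prop where
  zero : f ≫ g = 0
  exists_lift : ∀ {M : C} (h : M ⟶ Y), h ≫ g = 0 → ∃ t : M ⟶ X, t ≫ f = h
  exists_desc : ∀ {M : C} (h : Y ⟶ M), f ≫ h = 0 → ∃ t : Z ⟶ M, g ≫ t = h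

theorem WeakExact.of_iso {X Y Z X' Y' Z' : C} {f : X ⟶ Y} {g : Y ⟶ Z} {f' : X' ⟶ Y'}
    {g' : Y' ⟶ Z'} (h : WeakExact f g) (e₀ : X ≅ X') (e₁ : Y ≅ Y') (e₂ : Z ≅ Z')
    (hf : f ≫ e₁.hom = e₀.hom ≫ f') (hg : g ≫ e₂.hom = e₁.hom ≫ g') : WeakExact f' g' := by
  have hf' : f' = e₀.inv ≫ f ≫ e₁.hom := by rw [hf, Iso.inv_hom_id_assoc]
  have hg' : g' = e₁.inv ≫ g ≫ e₂.hom := by rw [hg, Iso.inv_hom_id_assoc]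
  refine ⟨by simp [hf', hg', reassoc_of% h.zero], fun {M} u hu => ?_, fun {M} u hu => ?_⟩
  · obtain ⟨t, ht⟩ := h.exists_lift (u ≫ e₁.inv) (by
      rw [← cancel_mono e₂.hom, zero_comp, ← hu, hg']; simp)
    exact ⟨t ≫ e₀.hom, by rw [hf', Category.assoc, Iso.hom_inv_id_assoc, reassoc_of% ht]; simp⟩
  · obtain ⟨t, ht⟩ := h.exists_desc (e₁.hom ≫ u) (by
      rw [← cancel_epi e₀.inv, comp_zero, ← hu, hf']; simp)
    exact ⟨e₂.inv ≫ t, by rw [hg']; simp [ht]⟩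

end WeakExact

/-! ### Weak exactness of angles under rotation -/

section Angles

open SigmaSeq

variable {C : Type u} [Category.{v} C] {S : C ⥤ C} {d n : ℕ}

theorem SigmaSeq.rotMap_castSucc (A : SigmaSeq S d) (j : Fin d) :
    A.rotMap j.castSucc
      = (A.rotIso j.castSucc).hom ≫ A.map j.succ ≫ (A.rotIso j.succ).inv := by
  unfold rotMap
  rw [Fin.lastCases_castSucc]

theorem SigmaSeq.rotMap_last (A : SigmaSeq S d) :
    A.rotMap (Fin.last d) = (A.rotIso (Fin.last d)).hom ≫ A.conn ≫ A.rotIsoLast.inv := by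
  unfold rotMap
  rw [Fin.lastCases_last]

variable [Preadditive C]

theorem neg_one_zpow_smul_injective {X Y : C} (d : ℕ) {f g : X ⟶ Y}
    (h : (-1 : ℤ) ^ d • f = (-1 : ℤ) ^ d • g) : f = g := by
  rcases neg_one_pow_eq_or ℤ d with h1 | h1 <;> rw [h1] at h <;> simpa using h

/-- Extracts a factorization from the last square of a morphism between rotated angles: the sign
occurs on both sides and cancels. -/
theorem map_eq_comp_of_rotated_square [S.Full] {M N T T' A R R' : C} (d : ℕ)
    (a : T' ≅ S.obj M) (b : T ≅ M) (a' : R' ≅ S.obj A) (c : R ≅ N) (g : M ⟶ N) (f : A ⟶ N) (φ : T' ⟶ R')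
    (h : (a.hom ≫ ((-1 : ℤ) ^ d • S.map (𝟙 M)) ≫ S.map b.inv) ≫ S.map (b.hom ≫ g ≫ c.inv) =
      φ ≫ a'.hom ≫ ((-1 : ℤ) ^ d • S.map f) ≫ S.map c.inv) :
    S.map g = S.map (S.preimage (a.inv ≫ φ ≫ a'.hom)) ≫ S.map f := by
  apply neg_one_zpow_smul_injective d
  have hb : S.map b.inv ≫ S.map b.hom = 𝟙 _ := by rw [← S.map_comp, b.inv_hom_id, S.map_id]
  rw [S.map_comp, S.map_comp, Category.assoc, Category.assoc, reassoc_of% hb, S.map_id] at h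
  rw [S.map_preimage, ← cancel_mono (S.map c.inv), ← cancel_epi a.hom]
  simpa using h

variable [HasZeroObject C]

open scoped ZeroObject in
variable (S n) in
/-- The sequence `0 ⟶ M ⟶ M ⟶ 0 ⟶ ⋯`, whose second morphism is the identity. -/
noncomputable def shiftedTrivial (M : C) : SigmaSeq S (n + 1) where
  obj := Fin.cases (motive := fun _ => C) 0
    (Fin.cases (motive := fun _ => C) M (Fin.cases (motive := fun _ => C) M (fun _ => 0)))
  map := Fin.cases
    (motive := fun i : Fin (n + 2) =>
      (Fin.cases (motive := fun _ => C) 0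
    (Fin.cases (motive := fun _ => C) M (Fin.cases (motive := fun _ => C) M (fun _ => 0)))
          i.castSucc : C) ⟶
        Fin.cases (motive := fun _ => C) 0
    (Fin.cases (motive := fun _ => C) M (Fin.cases (motive := fun _ => C) M (fun _ => 0)))
          i.succ)
    0 (Fin.cases (𝟙 M) (fun _ => 0))
  conn := 0

theorem isZero_rotObj_shiftedTrivial [S.IsEquivalence] (M : C) (j : Fin (n + 1)) :
    IsZero ((shiftedTrivial S n M).rotObj j.succ.succ) := by
  induction j using Fin.lastCases with
  | last =>
    exact (S.map_isZero (isZero_zero C)).of_iso (shiftedTrivial S n M).rotIsoLast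
  | cast j =>
    exact (isZero_zero C).of_iso ((shiftedTrivial S n M).rotIso j.succ.succ)

theorem isZero_trivial_obj (M : C) (j : Fin (n + 1)) :
    IsZero ((SigmaSeq.trivial S (n + 1) M).obj j.succ.succ) :=
  isZero_zero C

variable [HasBinaryBiproducts C] {Θ : Set (SigmaSeq S (n + 1))}

/-- Its left rotation is isomorphic to the trivial angle on `M`, the last term being `S 0`. -/
theorem IsAngulated.shiftedTrivial_mem [S.IsEquivalence] (hΘ : IsAngulated S (n + 1) Θ) (M : C) :
    shiftedTrivial S n M ∈ Θ := by
  rw [← hΘ.rotate_mem_iff]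
  let Q := shiftedTrivial S n M
  let h : ∀ i : Fin (n + 3), (SigmaSeq.trivial S (n + 1) M).obj i ⟶ Q.rotObj i :=
    Fin.cases (Q.rotIso 0).inv (Fin.cases (Q.rotIso 1).inv (fun _ => 0))
  refine hΘ.of_iso (SigmaSeq.trivial S (n + 1) M) _ ⟨h, fun i => ?_, ?_⟩ (fun i => ?_)
    (hΘ.trivial_mem M)
  · induction i using Fin.cases with
    | zero =>
      change 𝟙 M ≫ (Q.rotIso 1).inv = (Q.rotIso 0).inv ≫ Q.rotMap (Fin.castSucc 0)
      rw [rotMap_castSucc]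
      change _ = (Q.rotIso 0).inv ≫ (Q.rotIso 0).hom ≫ 𝟙 M ≫ (Q.rotIso 1).inv
      rw [Iso.inv_hom_id_assoc]
      rfl
    | succ j => exact (isZero_rotObj_shiftedTrivial M j).eq_of_tgt _ _
  · exact (isZero_trivial_obj (S := S) M (Fin.last n)).eq_of_src _ _
  · induction i using Fin.cases with
    | zero => exact inferInstanceAs (IsIso (Q.rotIso 0).inv)
    | succ i =>
      induction i using Fin.cases with
      | zero => exact inferInstanceAs (IsIso (Q.rotIso 1).inv)
      | succ j =>
        exact ⟨0, (isZero_trivial_obj M j).eq_of_src _ _,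
          (isZero_rotObj_shiftedTrivial M j).eq_of_src _ _⟩

/-- Each clause is (N3) applied to a map from or to a (rotated) trivial angle. -/
theorem IsAngulated.weakExact_zero_one [S.IsEquivalence] (hΘ : IsAngulated S (n + 1) Θ)
    {A : SigmaSeq S (n + 1)} (hA : A ∈ Θ) :
    WeakExact (A.map 0) (A.map 1) where
  zero := by
    obtain ⟨φ, h0, h1⟩ := hΘ.exists_hom _ (hΘ.trivial_mem (A.obj 0)) A hA (𝟙 (A.obj 0)) A.first
      rfl
    have h2 : (0 : A.obj 0 ⟶ _) ≫ φ.hom 2 = φ.hom 1 ≫ A.map 1 := φ.comm 1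
    rw [h1, zero_comp] at h2
    exact h2.symm
  exists_lift {M} g hg := by
    let T := SigmaSeq.trivial S (n + 1) M
    have hT : T.rotate.first = 0 := by
      change T.rotMap (Fin.castSucc 0) = 0
      rw [rotMap_castSucc]
      have : T.map (Fin.succ 0) = 0 := rfl
      rw [this, zero_comp, comp_zero]
    have hA1 : A.rotate.first = (A.rotIso 0).hom ≫ A.map 1 ≫ (A.rotIso 1).inv :=
      rotMap_castSucc A 0
    -- The rotated trivial angle is `M ⟶ 0 ⟶ ⋯ ⟶ S M ⟶ S M`, so `g` and `0` form an admissible first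
    -- square; the last component `S M ⟶ S A_0` is the desired lift after undoing `S`.
    obtain ⟨φ, h0, -⟩ := hΘ.exists_hom _ ((hΘ.rotate_mem_iff T).2 (hΘ.trivial_mem M)) A.rotate
      ((hΘ.rotate_mem_iff A).2 hA) (T.rotIsoFirst.hom ≫ g ≫ A.rotIsoFirst.inv) 0 (by
        rw [hT, hA1, comp_zero]
        change 0 = (T.rotIsoFirst.hom ≫ g ≫ A.rotIsoFirst.inv) ≫ A.rotIsoFirst.hom ≫ _
        have aux : ∀ {P M N N' Q R : C} (a : P ⟶ M) (g : M ⟶ N) (c : N' ≅ N) (f : N ⟶ Q)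
            (e : Q ⟶ R), g ≫ f = 0 → 0 = (a ≫ g ≫ c.inv) ≫ c.hom ≫ f ≫ e := by
          intro P M N N' Q R a g c f e h
          simp [reassoc_of% h]
        exact aux _ _ _ _ _ hg)
    have h2 := φ.comm_conn
    rw [h0] at h2
    change (T.rotIsoLast.hom ≫ ((-1 : ℤ) ^ (n + 1) • S.map (𝟙 M)) ≫ S.map T.rotIsoFirst.inv) ≫ _ =
      φ.hom _ ≫ A.rotIsoLast.hom ≫ ((-1 : ℤ) ^ (n + 1) • S.map A.first) ≫ S.map A.rotIsoFirst.inv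
      at h2
    have h3 := map_eq_comp_of_rotated_square (n + 1) T.rotIsoLast T.rotIsoFirst A.rotIsoLast
      A.rotIsoFirst g A.first _ h2
    rw [← S.map_comp] at h3
    exact ⟨_, (S.map_injective h3).symm⟩
  exists_desc {M} g hg := by
    let Q := shiftedTrivial S n M
    obtain ⟨φ, -, h1⟩ := hΘ.exists_hom A hA Q (hΘ.shiftedTrivial_mem M) (0 : A.obj 0 ⟶ Q.obj 0) g
      (by rw [zero_comp]; exact hg)
    have h2 : A.map 1 ≫ φ.hom 2 = φ.hom 1 ≫ 𝟙 M := φ.comm 1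
    rw [h1] at h2
    exact ⟨φ.hom 2, h2.trans (Category.comp_id g)⟩

/-- Rotation moves positions `m + 1`, `m + 2` to `m`, `m + 1`. -/
theorem IsAngulated.weakExact_map [S.IsEquivalence] (hΘ : IsAngulated S (n + 1) Θ) (m : ℕ)
    (hm : m < n + 1) {A : SigmaSeq S (n + 1)} (hA : A ∈ Θ) :
    WeakExact (A.map ⟨m, by omega⟩) (A.map ⟨m + 1, by omega⟩) := by
  induction m generalizing A with
  | zero => exact hΘ.weakExact_zero_one hA
  | succ m ih =>
    have h1 := ih (by omega) ((hΘ.rotate_mem_iff A).2 hA)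
    have h2 := rotMap_castSucc A ⟨m, by omega⟩
    have h3 := rotMap_castSucc A ⟨m + 1, by omega⟩
    refine h1.of_iso (A.rotIso ⟨m, by omega⟩) (A.rotIso ⟨m + 1, by omega⟩)
      (A.rotIso ⟨m + 2, by omega⟩) ?_ ?_
    · change A.rotMap (Fin.castSucc ⟨m, by omega⟩) ≫ _ = _
      rw [h2]
      change ((A.rotIso ⟨m, by omega⟩).hom ≫ A.map ⟨m + 1, by omega⟩ ≫
        (A.rotIso ⟨m + 1, by omega⟩).inv) ≫ (A.rotIso ⟨m + 1, by omega⟩).hom = _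
      simp
      rfl
    · change A.rotMap (Fin.castSucc ⟨m + 1, by omega⟩) ≫ _ = _
      rw [h3]
      change ((A.rotIso ⟨m + 1, by omega⟩).hom ≫ A.map ⟨m + 2, by omega⟩ ≫
        (A.rotIso ⟨m + 2, by omega⟩).inv) ≫ (A.rotIso ⟨m + 2, by omega⟩).hom = _
      simp
      rfl

theorem IsAngulated.weakExact_last_conn [S.IsEquivalence] (hΘ : IsAngulated S (n + 1) Θ)
    {A : SigmaSeq S (n + 1)} (hA : A ∈ Θ) :
    WeakExact (A.map (Fin.last (n + 1))) A.conn := by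
  have h1 := hΘ.weakExact_map n (by omega) ((hΘ.rotate_mem_iff A).2 hA)
  have h2 := rotMap_castSucc A (Fin.last n)
  have h3 := rotMap_last A
  refine h1.of_iso (A.rotIso ⟨n, by omega⟩) (A.rotIso (Fin.last (n + 1))) A.rotIsoLast ?_ ?_
  · change A.rotMap (Fin.castSucc (Fin.last n)) ≫ _ = _
    rw [h2]
    change ((A.rotIso ⟨n, by omega⟩).hom ≫ A.map (Fin.last (n + 1)) ≫
        (A.rotIso (Fin.last (n + 1))).inv) ≫ (A.rotIso (Fin.last (n + 1))).hom = _
    simp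
    rfl
  · change A.rotMap (Fin.last (n + 1)) ≫ _ = _
    rw [h3]
    simp
    rfl

theorem IsAngulated.weakExact_conn_first [S.IsEquivalence] (hΘ : IsAngulated S (n + 1) Θ)
    {A : SigmaSeq S (n + 1)} (hA : A ∈ Θ) :
    WeakExact A.conn (S.map A.first) := by
  have h1 := hΘ.weakExact_last_conn ((hΘ.rotate_mem_iff A).2 hA)
  have h3 := rotMap_last A
  have h4 : WeakExact A.conn ((-1 : ℤ) ^ (n + 1) • S.map A.first) := by
    refine h1.of_iso (A.rotIso (Fin.last (n + 1))) A.rotIsoLast (S.mapIso A.rotIsoFirst) ?_ ?_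
    · change A.rotMap (Fin.last (n + 1)) ≫ _ = _
      rw [h3]
      simp
      rfl
    · change (A.rotIsoLast.hom ≫ ((-1 : ℤ) ^ (n + 1) • S.map A.first) ≫
        S.map A.rotIsoFirst.inv) ≫ S.map A.rotIsoFirst.hom = _
      rw [Category.assoc, Category.assoc, ← S.map_comp, Iso.inv_hom_id, S.map_id]
      simp
      rfl
  rcases neg_one_pow_eq_or ℤ (n + 1) with h5 | h5 <;> rw [h5] at h4
  · rwa [one_smul] at h4
  · refine h4.of_iso (Iso.refl _) (Iso.refl _) ⟨-𝟙 _, -𝟙 _, by simp, by simp⟩ (by simp) (by simp)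

/-- Every morphism `X ⟶ S Z` is, up to isomorphism, the last morphism of an angle. -/
theorem IsAngulated.exists_conn [S.IsEquivalence] (hΘ : IsAngulated S (n + 1) Θ) {X Z : C}
    (γ : X ⟶ S.obj Z) : ∃ A ∈ Θ, ∃ (e₀ : A.obj 0 ≅ Z) (e₁ : A.obj (Fin.last (n + 2)) ≅ X),
      A.conn ≫ S.map e₀.hom = e₁.hom ≫ γ := by
  -- The sign is chosen to cancel the one introduced by the rotation below.
  obtain ⟨A, hA, e₀, e₁, he⟩ := hΘ.exists_extension
    ((-1 : ℤ) ^ (n + 1) • S.preimage ((S.objObjPreimageIso X).hom ≫ γ))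
  refine ⟨A.rotate, (hΘ.rotate_mem_iff A).2 hA, A.rotIsoFirst ≪≫ e₁,
    A.rotIsoLast ≪≫ S.mapIso e₀ ≪≫ S.objObjPreimageIso X, ?_⟩
  have : S.Additive := Functor.additive_of_preserves_binary_products S
  change (A.rotIsoLast.hom ≫ ((-1 : ℤ) ^ (n + 1) • S.map A.first) ≫
        S.map A.rotIsoFirst.inv) ≫ S.map (A.rotIsoFirst.hom ≫ e₁.hom) =
    (A.rotIsoLast.hom ≫ S.map e₀.hom ≫ (S.objObjPreimageIso X).hom) ≫ γ
  rw [Category.assoc, Category.assoc, ← S.map_comp, Iso.inv_hom_id_assoc]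
  apply neg_one_zpow_smul_injective (n + 1)
  have h2 := congrArg S.map he
  rw [S.map_comp, S.map_comp, S.map_zsmul, S.map_preimage] at h2
  rcases neg_one_pow_eq_or ℤ (n + 1) with h5 | h5 <;> rw [h5] at h2 ⊢ <;> simp [h2]

end Angles

end HigherAngulated

namespace HigherAngulated

/-! ### Dimensions of endomorphism algebras of retracts -/

section Dimension

variable (k : Type w) [Field k] {C : Type u} [Category.{v} C] [Preadditive C] [Linear k C]

/-- The map on endomorphisms induced by a retract. -/
def retractEnd {X W : C} (j : W ⟶ X) (p : X ⟶ W) : (W ⟶ W) →ₗ[k] (X ⟶ X) :=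
  Linear.leftComp k X p ∘ₗ Linear.rightComp k W j

theorem retractEnd_injective {X W : C} {j : W ⟶ X} {p : X ⟶ W} (h : j ≫ p = 𝟙 W) :
    Function.Injective (retractEnd k j p) := by
  intro f g hfg
  have h1 : p ≫ f ≫ j = p ≫ g ≫ j := hfg
  have h2 := j ≫= h1 =≫ p
  simpa [h, reassoc_of% h] using h2

theorem finrank_end_le {X W : C} [FiniteDimensional k (X ⟶ X)] {j : W ⟶ X} {p : X ⟶ W}
    (h : j ≫ p = 𝟙 W) : Module.finrank k (W ⟶ W) ≤ Module.finrank k (X ⟶ X) :=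
  LinearMap.finrank_le_finrank_of_injective (retractEnd_injective k h)

theorem finrank_end_lt {X W : C} [FiniteDimensional k (X ⟶ X)] {j : W ⟶ X} {p : X ⟶ W}
    (h : j ≫ p = 𝟙 W) (h' : p ≫ j ≠ 𝟙 X) :
    Module.finrank k (W ⟶ W) < Module.finrank k (X ⟶ X) := by
  rw [← LinearMap.finrank_range_of_inj (retractEnd_injective k h)]
  apply Submodule.finrank_lt
  intro htop
  have h1 : 𝟙 X ∈ LinearMap.range (retractEnd k j p) := htop ▸ Submodule.mem_top
  obtain ⟨f, hf⟩ := h1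
  have h2 : p ≫ f ≫ j = 𝟙 X := hf
  apply h'
  calc p ≫ j = p ≫ j ≫ p ≫ f ≫ j := by rw [h2, Category.comp_id]
    _ = 𝟙 X := by rw [reassoc_of% h, h2]

end Dimension

/-! ### Removing contractible summands -/

section Splitting

variable {C : Type u} [Category.{v} C] [Preadditive C] [HasZeroObject C] [HasBinaryBiproducts C]
  {S : C ⥤ C} {d n : ℕ}

/-- A sequence of retracts of an angle, given by the kernels of split idempotents forming an
endomorphism of the angle, is an angle. -/
theorem IsAngulated.retract_mem [S.Additive] {Θ : Set (SigmaSeq S d)} (hΘ : IsAngulated S d Θ)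
    {A : SigmaSeq S d} (hA : A ∈ Θ) {W V : Fin (d + 2) → C} (j : ∀ i, W i ⟶ A.obj i)
    (p : ∀ i, A.obj i ⟶ W i) (j' : ∀ i, V i ⟶ A.obj i) (p' : ∀ i, A.obj i ⟶ V i)
    (q : ∀ i, A.obj i ⟶ A.obj i) (hjp : ∀ i, j i ≫ p i = 𝟙 _) (hpj : ∀ i, p i ≫ j i = 𝟙 _ - q i)
    (hjp' : ∀ i, j' i ≫ p' i = 𝟙 _) (hpj' : ∀ i, p' i ≫ j' i = q i)
    (hq : ∀ i : Fin (d + 1), A.map i ≫ q i.succ = q i.castSucc ≫ A.map i)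
    (hq' : A.conn ≫ S.map (q 0) = q (Fin.last (d + 1)) ≫ A.conn) :
    (⟨W, fun i => j i.castSucc ≫ A.map i ≫ p i.succ, j _ ≫ A.conn ≫ S.map (p 0)⟩ :
      SigmaSeq S d) ∈ Θ := by
  have hqp : ∀ i, q i ≫ p i = 0 := fun i => by
    have : q i = 𝟙 _ - p i ≫ j i := by rw [hpj]; abel
    simp [this, hjp]
  have hqp' : ∀ i, q i ≫ p' i = p' i := fun i => by rw [← hpj']; simp [hjp']
  have hjq : ∀ i, j i ≫ q i = 0 := fun i => by
    have : q i = 𝟙 _ - p i ≫ j i := by rw [hpj]; abel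
    simp [this, reassoc_of% hjp]
  have hjq' : ∀ i, j' i ≫ q i = j' i := fun i => by rw [← hpj']; simp [reassoc_of% hjp']
  have hjp0 : ∀ i, j i ≫ p' i = 0 := fun i => by
    rw [← hqp', reassoc_of% hjq, zero_comp]
  have hjp0' : ∀ i, j' i ≫ p i = 0 := fun i => by
    rw [← hjq', Category.assoc, hqp, comp_zero]
  let A₁ : SigmaSeq S d :=
    ⟨W, fun i => j i.castSucc ≫ A.map i ≫ p i.succ, j _ ≫ A.conn ≫ S.map (p 0)⟩
  let A₂ : SigmaSeq S d :=
    ⟨V, fun i => j' i.castSucc ≫ A.map i ≫ p' i.succ, j' _ ≫ A.conn ≫ S.map (p' 0)⟩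
  -- The kernels and the images of the `q i` form two sequences with direct sum isomorphic to `A`.
  refine hΘ.summand_mem A₁ A₂ (hΘ.of_iso A _ ⟨fun i => biprod.lift (p i) (p' i), fun i => ?_, ?_⟩
    (fun i => ?_) hA)
  · change A.map i ≫ biprod.lift (p i.succ) (p' i.succ) =
      biprod.lift (p i.castSucc) (p' i.castSucc) ≫
        biprod.map (j i.castSucc ≫ A.map i ≫ p i.succ) (j' i.castSucc ≫ A.map i ≫ p' i.succ)
    apply biprod.hom_ext
    · simp only [Category.assoc, biprod.lift_fst, biprod.map_fst, biprod.lift_fst_assoc]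
      rw [reassoc_of% hpj, Preadditive.sub_comp, Category.id_comp, ← reassoc_of% hq, hqp]
      simp
    · simp only [Category.assoc, biprod.lift_snd, biprod.map_snd, biprod.lift_snd_assoc]
      rw [reassoc_of% hpj', ← reassoc_of% hq, hqp']
  · change A.conn ≫ S.map (biprod.lift (p 0) (p' 0)) = biprod.lift (p _) (p' _) ≫
      biprod.desc ((j _ ≫ A.conn ≫ S.map (p 0)) ≫ S.map biprod.inl)
        ((j' _ ≫ A.conn ≫ S.map (p' 0)) ≫ S.map biprod.inr)
    have h1 : biprod.lift (p 0) (p' 0) = p 0 ≫ biprod.inl + p' 0 ≫ biprod.inr := by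
      apply biprod.hom_ext <;> simp
    rw [biprod.lift_desc, h1, S.map_add, S.map_comp, S.map_comp, Preadditive.comp_add]
    congr 1
    · simp only [Category.assoc]
      rw [reassoc_of% hpj, Preadditive.sub_comp, Category.id_comp, ← reassoc_of% hq',
        ← S.map_comp_assoc, hqp]
      simp
    · simp only [Category.assoc]
      rw [reassoc_of% hpj', ← reassoc_of% hq', ← S.map_comp_assoc, hqp']
  · refine ⟨biprod.desc (j i) (j' i), ?_, ?_⟩
    · change biprod.lift (p i) (p' i) ≫ biprod.desc (j i) (j' i) = _
      rw [biprod.lift_desc, hpj, hpj']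
      abel
    · change biprod.desc (j i) (j' i) ≫ biprod.lift (p i) (p' i) = 𝟙 (W i ⊞ V i)
      ext <;> simp [hjp, hjp', hjp0, hjp0']

variable {Θ : Set (SigmaSeq S (n + 1))} {k : Type w} [Field k] [Linear k C]

open scoped ZeroObject in
/-- A middle morphism of an angle that is not radical gives rise to a contractible summand, whose
complement is a smaller angle with the same connecting morphism. -/
theorem IsAngulated.exists_smaller [S.IsEquivalence] (hΘ : IsAngulated S (n + 1) Θ)
    (hfin : ∀ X Y : C, FiniteDimensional k (X ⟶ Y)) (hKS : IsKrullSchmidt C)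
    {A : SigmaSeq S (n + 1)} (hA : A ∈ Θ) {i : Fin (n + 2)} (hi : i ≠ 0)
    (hi' : i ≠ Fin.last (n + 1)) (hrad : ¬ IsRadical (A.map i)) :
    ∃ B ∈ Θ, ∃ (e₀ : B.obj 0 ≅ A.obj 0) (e₁ : B.obj (Fin.last (n + 2)) ≅ A.obj (Fin.last (n + 2))),
      B.conn ≫ S.map e₀.hom = e₁.hom ≫ A.conn ∧
      ∑ l, Module.finrank k (B.obj l ⟶ B.obj l) < ∑ l, Module.finrank k (A.obj l ⟶ A.obj l) := by
  have : S.Additive := Functor.additive_of_preserves_binary_products S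
  obtain ⟨Z, s, t, hZ, hst⟩ := hKS.exists_of_not_isRadical hrad
  -- The idempotents projecting onto the summand `Z ⟶ Z` cut out by `s` and `t` at the two ends of
  -- `A.map i`. They commute with the neighbouring morphisms since consecutive composites vanish.
  let q : ∀ l, A.obj l ⟶ A.obj l := Function.update (Function.update (fun _ => 0) i.castSucc
    (A.map i ≫ t ≫ s)) i.succ (t ≫ s ≫ A.map i)
  have hne : i.castSucc ≠ i.succ := (Fin.castSucc_lt_succ).ne
  have hq1 : q i.succ = t ≫ s ≫ A.map i := Function.update_self _ _ _
  have hq2 : q i.castSucc = A.map i ≫ t ≫ s := by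
    simp only [q]
    rw [Function.update_of_ne hne, Function.update_self]
  have hq3 : ∀ l, l ≠ i.castSucc → l ≠ i.succ → q l = 0 := fun l h1 h2 => by
    simp only [q]
    rw [Function.update_of_ne h2, Function.update_of_ne h1]
  clear_value q
  -- Since `i` is neither first nor last, both end terms and the connecting morphism survive
  -- unchanged.
  have hq0 : q 0 = 0 := hq3 0 (fun h => hi (by simpa using h.symm)) (Fin.succ_ne_zero i).symm
  have hqlast : q (Fin.last (n + 2)) = 0 :=
    hq3 _ (Fin.castSucc_lt_last i).ne' (fun h => hi' (by simpa using h.symm))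
  have hcomm : ∀ l : Fin (n + 2), A.map l ≫ q l.succ = q l.castSucc ≫ A.map l := by
    intro l
    by_cases hl : l = i
    · subst hl
      rw [hq1, hq2]
      simp
    · have h1 : A.map l ≫ q l.succ = 0 := by
        by_cases h : l.succ = i.castSucc
        · have hv : (l : ℕ) + 1 = i := by simpa using congrArg Fin.val h
          obtain ⟨i, hi2⟩ := i
          obtain rfl : (l : ℕ) + 1 = i := hv
          have hz := (hΘ.weakExact_map l (by omega) hA).zero
          refine (A.map l ≫= hq2).trans ?_
          exact (Category.assoc (A.map l) (A.map ⟨l + 1, _⟩) (t ≫ s)).symm.trans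
            ((hz =≫ (t ≫ s)).trans zero_comp)
        · rw [hq3 _ h (fun h' => hl (Fin.succ_injective _ h')), comp_zero]
      have h2 : q l.castSucc ≫ A.map l = 0 := by
        by_cases h : l.castSucc = i.succ
        · have hv : (l : ℕ) = i + 1 := by simpa using congrArg Fin.val h
          obtain ⟨l, hl2⟩ := l
          obtain rfl : l = (i : ℕ) + 1 := hv
          have hz := (hΘ.weakExact_map i (by omega) hA).zero
          refine (hq1 =≫ A.map ⟨i + 1, _⟩).trans ?_
          rw [← Category.assoc]
          exact (Category.assoc (t ≫ s) (A.map i) (A.map ⟨i + 1, _⟩)).trans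
            (((t ≫ s) ≫= hz).trans comp_zero)
        · rw [hq3 _ (fun h' => hl (Fin.castSucc_injective _ h')) h, zero_comp]
      rw [h1, h2]
  have hsplit : ∀ l, ∃ (W V : C) (j : W ⟶ A.obj l) (p : A.obj l ⟶ W) (j' : V ⟶ A.obj l)
      (p' : A.obj l ⟶ V), j ≫ p = 𝟙 _ ∧ p ≫ j = 𝟙 _ - q l ∧ j' ≫ p' = 𝟙 _ ∧ p' ≫ j' = q l := by
    intro l
    by_cases h1 : l = i.castSucc
    · subst h1
      obtain ⟨W, j, p, h2, h3⟩ := hKS.exists_complement hZ (s := s) (r := A.map i ≫ t) hst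
      exact ⟨W, Z, j, p, s, A.map i ≫ t, h2, by rw [h3, hq2, Category.assoc], hst,
        by rw [hq2, Category.assoc]⟩
    by_cases h2 : l = i.succ
    · subst h2
      obtain ⟨W, j, p, h2, h3⟩ := hKS.exists_complement hZ (s := s ≫ A.map i) (r := t)
        (by rw [Category.assoc, hst])
      exact ⟨W, Z, j, p, s ≫ A.map i, t, h2, by rw [h3, hq1], by rw [Category.assoc, hst], hq1.symm⟩
    · exact ⟨A.obj l, 0, 𝟙 _, 𝟙 _, 0, 0, by simp, by simp [hq3 l h1 h2],
        (isZero_zero C).eq_of_src _ _, by simp [hq3 l h1 h2]⟩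
  choose W V j p j' p' hjp hpj hjp' hpj' using hsplit
  refine ⟨_, hΘ.retract_mem hA j p j' p' q hjp hpj hjp' hpj' hcomm ?_,
    ⟨j 0, p 0, hjp 0, by rw [hpj, hq0, sub_zero]⟩,
    ⟨j _, p _, hjp _, by rw [hpj, hqlast, sub_zero]⟩, ?_, ?_⟩
  · rw [hq0, hqlast, S.map_zero, comp_zero, zero_comp]
  · change (j _ ≫ A.conn ≫ S.map (p 0)) ≫ S.map (j 0) = j _ ≫ A.conn
    rw [Category.assoc, Category.assoc, ← S.map_comp, hpj, hq0, sub_zero, S.map_id,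
      Category.comp_id]
  · refine Finset.sum_lt_sum (fun l _ => finrank_end_le k (hjp l))
      ⟨i.castSucc, Finset.mem_univ _, finrank_end_lt k (hjp _) fun h => ?_⟩
    rw [hpj, sub_eq_self, hq2] at h
    apply id_ne_zero_of_local hZ
    calc 𝟙 Z = s ≫ (A.map i ≫ t ≫ s) ≫ A.map i ≫ t := by simp [hst]
      _ = 0 := by rw [h]; simp

/-- Every connecting morphism occurs in an angle whose middle morphisms are radical. -/
theorem IsAngulated.exists_radical [S.IsEquivalence] (hΘ : IsAngulated S (n + 1) Θ)
    (hfin : ∀ X Y : C, FiniteDimensional k (X ⟶ Y)) (hKS : IsKrullSchmidt C) {X Z : C}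
    (γ : X ⟶ S.obj Z) : ∃ A ∈ Θ, ∃ (e₀ : A.obj 0 ≅ Z) (e₁ : A.obj (Fin.last (n + 2)) ≅ X),
      A.conn ≫ S.map e₀.hom = e₁.hom ≫ γ ∧
      ∀ i, i ≠ 0 → i ≠ Fin.last (n + 1) → IsRadical (A.map i) := by
  obtain ⟨A, hA, e₀, e₁, he⟩ := hΘ.exists_conn γ
  induction hN : ∑ l, Module.finrank k (A.obj l ⟶ A.obj l) using Nat.strong_induction_on
    generalizing A with
  | _ N ih =>
    by_cases h : ∀ i, i ≠ 0 → i ≠ Fin.last (n + 1) → IsRadical (A.map i)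
    · exact ⟨A, hA, e₀, e₁, he, h⟩
    · push Not at h
      obtain ⟨i, hi, hi', hrad⟩ := h
      obtain ⟨B, hB, f₀, f₁, hf, hlt⟩ := hΘ.exists_smaller hfin hKS hA hi hi' hrad
      exact ih _ (hN ▸ hlt) B hB (f₀ ≪≫ e₀) (f₁ ≪≫ e₁)
        (by simp [reassoc_of% hf, he]) rfl

end Splitting

/-! ### Constructing Auslander–Reiten angles -/

section AuslanderReiten

variable {C : Type u} [Category.{v} C] [Preadditive C] [HasZeroObject C] [HasBinaryBiproducts C]
  {S : C ⥤ C} [S.IsEquivalence] {n : ℕ} {Θ : Set (SigmaSeq S (n + 1))}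

/-- If `γ ≫ S.map g` were nonzero, the morphism preceding it in an angle would not be a retraction,
hence would be annihilated by `γ`. Then `γ` factors through `γ ≫ S.map g`, say `γ = γ ≫ S.map (g ≫
u)`, and locality of `End Z` makes `g` a section or `γ` zero. -/
theorem IsAngulated.comp_eq_zero_of_nonsection (hΘ : IsAngulated S (n + 1) Θ) {X Z : C}
    (hZ : IsLocalRing (End Z)) {γ : X ⟶ S.obj Z} (hγ : γ ≠ 0)
    (h : ∀ {M : C} (g : M ⟶ X), ¬ IsSplitEpi g → g ≫ γ = 0) {M : C} (g : Z ⟶ M)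
    (hg : ¬ IsSplitMono g) : γ ≫ S.map g = 0 := by
  have : S.Additive := Functor.additive_of_preserves_binary_products S
  by_contra hδ
  obtain ⟨B, hB, e₀, e₁, he⟩ := hΘ.exists_conn (γ ≫ S.map g)
  have hex := hΘ.weakExact_last_conn hB
  have h1 : (B.map (Fin.last (n + 1)) ≫ e₁.hom) ≫ γ = 0 := by
    apply h
    rintro ⟨⟨s, hs⟩⟩
    apply hδ
    calc γ ≫ S.map g = (s ≫ B.map (Fin.last (n + 1)) ≫ e₁.hom) ≫ γ ≫ S.map g := by
          rw [hs, Category.id_comp]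
      _ = s ≫ (B.map (Fin.last (n + 1)) ≫ B.conn) ≫ S.map e₀.hom := by simp [he]
      _ = 0 := by rw [hex.zero]; simp
  obtain ⟨t, ht⟩ := hex.exists_desc (e₁.hom ≫ γ) (by rw [← Category.assoc]; exact h1)
  have h2 : γ = (γ ≫ S.map g) ≫ S.map e₀.inv ≫ t := by
    rw [← cancel_epi e₁.hom, ← ht, ← Category.assoc e₁.hom, ← he, Category.assoc, ← S.map_comp_assoc]
    simp
  obtain ⟨u, hu⟩ := S.map_surjective (S.map e₀.inv ≫ t)
  rw [← hu, Category.assoc, ← S.map_comp] at h2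
  rcases isIso_or_isIso_one_sub hZ (g ≫ u) with h3 | h3
  · exact hg ⟨⟨u ≫ inv (g ≫ u), by rw [← Category.assoc, IsIso.hom_inv_id]⟩⟩
  · apply hγ
    rw [← cancel_mono (S.map (𝟙 Z - g ≫ u)), S.map_sub, Preadditive.comp_sub, ← h2, S.map_id,
      Category.comp_id, sub_self, zero_comp]

/-- Dual argument: the first morphism of an angle on `g ≫ γ` is not a section, so `γ` factors as `v
≫ g ≫ γ`, and `End X` is local. -/
theorem IsAngulated.comp_eq_zero_of_nonretraction (hΘ : IsAngulated S (n + 1) Θ) {X Z : C}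
    (hX : IsLocalRing (End X)) {γ : X ⟶ S.obj Z} (hγ : γ ≠ 0)
    (h : ∀ {M : C} (g : Z ⟶ M), ¬ IsSplitMono g → γ ≫ S.map g = 0) {M : C} (g : M ⟶ X)
    (hg : ¬ IsSplitEpi g) : g ≫ γ = 0 := by
  have : S.Additive := Functor.additive_of_preserves_binary_products S
  by_contra hδ
  obtain ⟨B, hB, e₀, e₁, he⟩ := hΘ.exists_conn (g ≫ γ)
  have hex := hΘ.weakExact_conn_first hB
  have h0 : B.conn = e₁.hom ≫ (g ≫ γ) ≫ S.map e₀.inv := by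
    rw [← Category.assoc, ← he, Category.assoc, ← S.map_comp, e₀.hom_inv_id]
    simp
  have h1 : γ ≫ S.map (e₀.inv ≫ B.first) = 0 := by
    apply h
    rintro ⟨⟨s, hs⟩⟩
    apply hδ
    calc g ≫ γ = (g ≫ γ) ≫ S.map ((e₀.inv ≫ B.first) ≫ s) := by
          rw [hs, S.map_id, Category.comp_id]
      _ = e₁.inv ≫ (B.conn ≫ S.map B.first) ≫ S.map s := by simp [h0]
      _ = 0 := by rw [hex.zero]; simp
  obtain ⟨t, ht⟩ := hex.exists_lift (γ ≫ S.map e₀.inv)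
    (by rw [Category.assoc, ← S.map_comp]; exact h1)
  have h2 : γ = ((t ≫ e₁.hom) ≫ g) ≫ γ := by
    rw [← cancel_mono (S.map e₀.inv), ← ht, h0]
    simp
  rcases isIso_or_isIso_one_sub hX ((t ≫ e₁.hom) ≫ g) with h3 | h3
  · exact hg ⟨⟨inv ((t ≫ e₁.hom) ≫ g) ≫ t ≫ e₁.hom, by
      rw [Category.assoc, IsIso.inv_comp_eq, Category.comp_id]⟩⟩
  · apply hγ
    rw [← cancel_epi (𝟙 X - (t ≫ e₁.hom) ≫ g), Preadditive.sub_comp, ← h2, Category.id_comp,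
      sub_self, comp_zero]

variable {k : Type w} [Field k] [Linear k C]

/-- A nonzero morphism `X ⟶ S Z` annihilated by all nonretractions to `X` and all nonsections from
`Z` is, up to isomorphism, the last morphism of an Auslander–Reiten angle. -/
theorem IsAngulated.exists_isAuslanderReiten (hΘ : IsAngulated S (n + 1) Θ)
    (hfin : ∀ X Y : C, FiniteDimensional k (X ⟶ Y)) (hKS : IsKrullSchmidt C) {X Z : C}
    {γ : X ⟶ S.obj Z} (hγ : γ ≠ 0)
    (hX : ∀ {M : C} (g : M ⟶ X), ¬ IsSplitEpi g → g ≫ γ = 0)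
    (hZ : ∀ {M : C} (g : Z ⟶ M), ¬ IsSplitMono g → γ ≫ S.map g = 0) :
    ∃ A, IsAuslanderReiten Θ A ∧ Nonempty (A.obj 0 ≅ Z) ∧
      Nonempty (A.obj (Fin.last (n + 2)) ≅ X) := by
  have : S.Additive := Functor.additive_of_preserves_binary_products S
  obtain ⟨A, hA, e₀, e₁, he, hrad⟩ := hΘ.exists_radical hfin hKS γ
  have h0 : A.conn = e₁.hom ≫ γ ≫ S.map e₀.inv := by
    rw [← Category.assoc, ← he, Category.assoc, ← S.map_comp, e₀.hom_inv_id]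
    simp
  have hne : A.conn ≠ 0 := fun h => hγ (by
    rw [← cancel_epi e₁.hom, ← he, h, zero_comp, comp_zero])
  have hex := hΘ.weakExact_conn_first hA
  have hex' := hΘ.weakExact_last_conn hA
  refine ⟨A, ⟨hA, ⟨?_, fun M g hg => ?_⟩, ⟨?_, fun M g hg => ?_⟩, hrad⟩, ⟨e₀⟩, ⟨e₁⟩⟩
  · rintro ⟨⟨s, hs⟩⟩
    apply hne
    calc A.conn = A.conn ≫ S.map (A.first ≫ s) := by rw [hs, S.map_id, Category.comp_id]
      _ = 0 := by rw [S.map_comp, reassoc_of% hex.zero, zero_comp]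
  · have h1 : γ ≫ S.map (e₀.inv ≫ g) = 0 := hZ _ (by
      rintro ⟨⟨s, hs⟩⟩
      refine hg ⟨⟨s ≫ e₀.inv, ?_⟩⟩
      rw [← cancel_epi e₀.inv, ← Category.assoc, ← Category.assoc, hs]
      simp)
    obtain ⟨t, ht⟩ := hex.exists_desc (S.map g) (by
      rw [h0, Category.assoc, Category.assoc, ← S.map_comp, h1, comp_zero])
    obtain ⟨u, rfl⟩ := S.map_surjective t
    exact ⟨u, S.map_injective (by rw [S.map_comp, ht])⟩
  · rintro ⟨⟨s, hs⟩⟩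
    apply hne
    calc A.conn = (s ≫ A.map (Fin.last (n + 1))) ≫ A.conn := by
          rw [hs]; exact (Category.id_comp A.conn).symm
      _ = 0 := by rw [Category.assoc, hex'.zero, comp_zero]
  · have h1 : (g ≫ e₁.hom) ≫ γ = 0 := hX _ (by
      rintro ⟨⟨s, hs⟩⟩
      refine hg ⟨⟨e₁.hom ≫ s, ?_⟩⟩
      rw [← cancel_mono e₁.hom, Category.assoc, Category.assoc, hs]
      exact (Category.comp_id _).trans (Category.id_comp _).symm)
    exact hex'.exists_lift g (by
      rw [h0]
      exact (by simp : g ≫ e₁.hom ≫ γ ≫ S.map e₀.inv = ((g ≫ e₁.hom) ≫ γ) ≫ S.map e₀.inv).trans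
        (by rw [h1, zero_comp]))

theorem isLocalRing_end_of_map (S : C ⥤ C) [S.IsEquivalence] {Z : C}
    (h : IsLocalRing (End (S.obj Z))) : IsLocalRing (End Z) := by
  have : S.Additive := Functor.additive_of_preserves_binary_products S
  have : Nontrivial (End Z) := by
    refine ⟨1, 0, fun h0 => id_ne_zero_of_local h ?_⟩
    have h' : 𝟙 Z = 0 := h0
    rw [← S.map_id, h', S.map_zero]
  refine IsLocalRing.of_is_unit_or_is_unit_of_add_one fun {a b} hab => ?_
  have hab' : (a : Z ⟶ Z) + b = 𝟙 Z := hab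
  have : IsIso (S.map a + S.map b) := by
    rw [← S.map_add, hab']; infer_instance
  rcases isIso_or_isIso_of_add h this with h | h
  · exact Or.inl ((isUnit_iff_isIso _).2 (isIso_of_reflects_iso a S))
  · exact Or.inr ((isUnit_iff_isIso _).2 (isIso_of_reflects_iso b S))

theorem IsAngulated.exists_isAuslanderReiten_ending (hΘ : IsAngulated S (n + 1) Θ)
    (hfin : ∀ X Y : C, FiniteDimensional k (X ⟶ Y)) (hKS : IsKrullSchmidt C)
    (hlf : IsLocallyFinite C) {X : C} (hX : Indecomposable X) :
    ∃ A, IsAuslanderReiten Θ A ∧ Nonempty (A.obj (Fin.last (n + 2)) ≅ X) := by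
  obtain ⟨Y, f, hf, hf'⟩ := exists_isRightAlmostSplit hfin hKS hlf hX
  obtain ⟨B, hB, e₀, e₁, he⟩ := hΘ.exists_extension f
  -- Only weak exactness at `B_1 ≅ X` is needed from this angle; it is not itself the one sought.
  obtain ⟨T, β, hex⟩ : ∃ (T : C) (β : B.obj 1 ⟶ T), WeakExact B.first β :=
    ⟨_, B.map 1, hΘ.weakExact_zero_one hB⟩
  have hne : β ≠ 0 := by
    intro h
    obtain ⟨t, ht⟩ := hex.exists_lift (𝟙 (B.obj 1)) (by rw [h, comp_zero])
    refine hf ⟨⟨e₁.inv ≫ t ≫ e₀.hom, ?_⟩⟩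
    rw [Category.assoc, Category.assoc, ← he, reassoc_of% ht, Iso.inv_hom_id]
  have hkill : ∀ {M : C} (g : M ⟶ X), ¬ IsSplitEpi g → g ≫ e₁.inv ≫ β = 0 := by
    intro M g hg
    obtain ⟨t, rfl⟩ := hf' g hg
    have : f ≫ e₁.inv = e₀.inv ≫ B.first := by
      rw [Iso.eq_inv_comp, ← Category.assoc, ← he, Category.assoc, Iso.hom_inv_id,
        Category.comp_id]
    rw [Category.assoc, reassoc_of% this, hex.zero, comp_zero, comp_zero]
  obtain ⟨m, Y', ι, π, hY, h1, h2, h3⟩ := hKS.exists_decomposition T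
  obtain ⟨l, hl⟩ : ∃ l, β ≫ π l ≠ 0 := by
    by_contra! hc
    apply hne
    have := β ≫= h3
    rw [Preadditive.comp_sum, Category.comp_id] at this
    rw [← this]
    exact Finset.sum_eq_zero fun i _ => by rw [← Category.assoc, hc, zero_comp]
  -- Essential surjectivity of `S` presents the chosen summand as `S Z`, the required target of a
  -- connecting morphism.
  let e := S.objObjPreimageIso (Y' l)
  let γ : X ⟶ S.obj (S.objPreimage (Y' l)) := e₁.inv ≫ (β ≫ π l) ≫ e.inv
  have hγ : γ ≠ 0 := by
    intro h
    apply hl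
    rw [← cancel_mono e.inv, zero_comp]
    exact (cancel_epi e₁.inv).1 (h.trans comp_zero.symm)
  have hZ : IsLocalRing (End (S.objPreimage (Y' l))) :=
    isLocalRing_end_of_map S (isLocalRing_end_of_iso e.symm (hY l))
  have hγX : ∀ {M : C} (g : M ⟶ X), ¬ IsSplitEpi g → g ≫ γ = 0 := by
    intro M g hg
    have := hkill g hg =≫ (π l ≫ e.inv)
    simpa [γ] using this
  obtain ⟨A, hA, -, hA'⟩ := hΘ.exists_isAuslanderReiten hfin hKS hγ hγX
    (hΘ.comp_eq_zero_of_nonsection hZ hγ hγX)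
  exact ⟨A, hA, hA'⟩

theorem IsAngulated.exists_isAuslanderReiten_starting (hΘ : IsAngulated S (n + 1) Θ)
    (hfin : ∀ X Y : C, FiniteDimensional k (X ⟶ Y)) (hKS : IsKrullSchmidt C)
    (hlf : IsLocallyFinite C) {X : C} (hX : Indecomposable X) :
    ∃ A, IsAuslanderReiten Θ A ∧ Nonempty (A.obj 0 ≅ X) := by
  have : S.Additive := Functor.additive_of_preserves_binary_products S
  obtain ⟨Y, f, hf, hf'⟩ := exists_isLeftAlmostSplit hfin hKS hlf hX
  obtain ⟨B, hB, e₀, e₁, he⟩ := hΘ.exists_extension f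
  have hex := hΘ.weakExact_conn_first hB
  -- If it vanished, the weak cokernel property would split `S.map B.first`, hence `f`.
  have hne : B.conn ≠ 0 := by
    intro h
    obtain ⟨t, ht⟩ := hex.exists_desc (𝟙 _) (by rw [h, zero_comp])
    obtain ⟨u, rfl⟩ := S.map_surjective t
    rw [← S.map_comp, ← S.map_id] at ht
    have hu := S.map_injective ht
    refine hf ⟨⟨e₁.inv ≫ u ≫ e₀.hom, ?_⟩⟩
    rw [← cancel_epi e₀.hom, ← reassoc_of% he]
    simp [reassoc_of% hu]
  have hkill : ∀ {M : C} (g : X ⟶ M), ¬ IsSplitMono g →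
      B.conn ≫ S.map e₀.hom ≫ S.map g = 0 := by
    intro M g hg
    obtain ⟨t, rfl⟩ := hf' g hg
    rw [← S.map_comp, ← reassoc_of% he, S.map_comp, reassoc_of% hex.zero, zero_comp]
  obtain ⟨m, Y', ι, π, hY, h1, h2, h3⟩ := hKS.exists_decomposition (B.obj (Fin.last (n + 2)))
  obtain ⟨l, hl⟩ : ∃ l, ι l ≫ B.conn ≠ 0 := by
    by_contra! hc
    apply hne
    have := h3 =≫ B.conn
    rw [Preadditive.sum_comp, Category.id_comp] at this
    rw [← this]
    exact Finset.sum_eq_zero fun i _ => by rw [Category.assoc, hc, comp_zero]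
  let γ : Y' l ⟶ S.obj X := (ι l ≫ B.conn) ≫ S.map e₀.hom
  have hγ : γ ≠ 0 := by
    intro h
    apply hl
    rw [← cancel_mono (S.map e₀.hom), zero_comp]
    exact h
  have hγX : ∀ {M : C} (g : X ⟶ M), ¬ IsSplitMono g → γ ≫ S.map g = 0 := by
    intro M g hg
    simp [γ, hkill g hg]
  obtain ⟨A, hA, hA', -⟩ := hΘ.exists_isAuslanderReiten hfin hKS hγ
    (hΘ.comp_eq_zero_of_nonretraction (hY l) hγ hγX) hγX
  exact ⟨A, hA, hA'⟩

end AuslanderReiten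

end HigherAngulated

theorem theorem3p8 {k : Type w} [Field k] {C : Type u} [Category.{v} C] [Preadditive C]
    [Linear k C] [HasZeroObject C] [HasBinaryBiproducts C]
    (hfin : ∀ X Y : C, FiniteDimensional k (X ⟶ Y))
    (hKS : HigherAngulated.IsKrullSchmidt C)
    (S : C ⥤ C) [S.IsEquivalence] (d : ℕ) (hd : 1 ≤ d)
    (Θ : Set (HigherAngulated.SigmaSeq S d)) (hΘ : HigherAngulated.IsAngulated S d Θ)
    (hlf : HigherAngulated.IsLocallyFinite C) :
    (∀ X : C, Indecomposable X → ∃ A, HigherAngulated.IsAuslanderReiten Θ A ∧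
      Nonempty (A.obj (Fin.last (d + 1)) ≅ X)) ∧
    (∀ X : C, Indecomposable X → ∃ A, HigherAngulated.IsAuslanderReiten Θ A ∧
      Nonempty (A.obj 0 ≅ X)) ∧
    HigherAngulated.HasAuslanderReitenAngles Θ := by
  obtain ⟨n, rfl⟩ : ∃ n, d = n + 1 := ⟨d - 1, by omega⟩
  have h1 := fun (X : C) (hX : Indecomposable X) =>
    hΘ.exists_isAuslanderReiten_ending hfin hKS hlf hX
  have h2 := fun (X : C) (hX : Indecomposable X) =>
    hΘ.exists_isAuslanderReiten_starting hfin hKS hlf hX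
  exact ⟨h1, h2, fun X hX => ⟨h1 X hX, h2 X hX⟩⟩
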